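/- Let $p\in\mathbb{N}$ and let $\mathcal P_2(\mathbb R^p)$ be the set of Borel probability measures on $\mathbb R^p$ with finite second moment, with the Wasserstein distance $W_2$. Let $k:\mathbb R^p\times\mathbb R^p\to\mathbb R$ be a symmetric kernel (for example a positive definite one) that is differentiable and whose gradient in the first argument grows at most linearly: there is $C$ with $\|\nabla_1 k(x,y)\|\le C(1+\|x\|+\|y\|)$ for all $x,y$ (this holds in particular if the gradient of $k$ is Lipschitz). Let $\mu\in\mathcal P_2(\mathbb R^p)$ and let $T:\mathbb R^p\to\mathbb R^p$ be Lipschitz and differentiable $\mu$-almost everywhere. For $\nu,\nu'\in\mathcal P_2(\mathbb R^p)$ put $$\mathrm{MMD}^2(\nu,\nu')=\iint k(x,y)\,\mathrm d(\nu-\nu')(x)\,\mathrm d(\nu-\nu')(y),\qquad \mathcal G(\nu)=\tfrac12\,\mathrm{MMD}^2(\nu,T_\#\nu),$$ and define the witness function $$f_\mu=\int k(\cdot,y)\,\mathrm d\mu(y)-\int k(\cdot,y)\,\mathrm d(T_\#\mu)(y).$$ A Wasserstein gradient of $\mathcal G$ at $\mu$ is a map $\xi\in L^2(\mu;\mathbb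 R^p)$ such that $$\mathcal G(\nu)=\mathcal G(\mu)+\int\langle\xi(x),y-x\rangle\,\mathrm d\gamma(x,y)+o\big(W_2(\mu,\nu)\big)$$ as $W_2(\mu,\nu)\to0$, uniformly over all $\nu\in\mathcal P_2(\mathbb R^p)$ and all optimal couplings $\gamma$ of $\mu$ and $\nu$ for the cost $\|x-y\|^2$ (that is, $\xi$ lies in both the sub- and the super-differential of $\mathcal G$ at $\mu$); the Wasserstein gradient $\nabla_W\mathcal G(\mu)$ is the one that lies in the tangent space $\overline{\{\nabla\psi:\psi\in C_c^\infty(\mathbb R^p)\}}^{L^2(\mu)}$. Then $T_\#\nu\in\mathcal P_2(\mathbb R^p)$ for every $\nu\in\mathcal P_2(\mathbb R^p)$, all integrals above converge absolutely (so $\mathcal G$ is well defined and finite on $\mathcal P_2(\mathbb R^p)$), $f_\mu$ is differentiable, $f_\mu\circ T$ is differentiable $\mu$-almost everywhere, the Wasserstein gradient of $\mathcal G$ at $\mu$ exists and is unique up to $\mu$-null sets, and $$\nabla_W\mathcal G(\mu)=\nabla f_\mu-\nabla(f_\mu\circ T)\qquad \mu\text{-almost everywhere.}$$ -/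

import Mathlib

open MeasureTheory
open scoped ENNReal ContDiff

noncomputable section

/-- The Euclidean space `ℝᵖ` with the Euclidean norm and its Borel sigma-algebra. -/
abbrev E (p : ℕ) : Type := EuclideanSpace ℝ (Fin p)

/-- `μ` is a probability measure on `ℝᵖ` with finite second moment. -/
def IsP2 {p : ℕ} (μ : Measure (E p)) : Prop :=
  IsProbabilityMeasure μ ∧ ∫⁻ x, ‖x‖ₑ ^ 2 ∂μ < ⊤

/-- The space `𝒫₂(ℝᵖ)`. -/
def P2 (p : ℕ) : Type := {μ : Measure (E p) // IsP2 μ}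

/-- Couplings of `μ` and `ν`. (They have finite second moments as soon as `μ` and `ν` do.) -/
def couplings {p : ℕ} (μ ν : Measure (E p)) : Set (Measure (E p × E p)) :=
  {γ | γ.map Prod.fst = μ ∧ γ.map Prod.snd = ν}

/-- The quadratic transport cost `∫ ‖x - y‖² dγ(x, y)`. -/
def transportCost {p : ℕ} (γ : Measure (E p × E p)) : ℝ≥0∞ :=
  ∫⁻ z, ‖z.1 - z.2‖ₑ ^ 2 ∂γ

/-- Optimal couplings of `μ` and `ν` for the quadratic cost. -/
def optimalCouplings {p : ℕ} (μ ν : Measure (E p)) : Set (Measure (E p × E p)) :=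
  {γ | γ ∈ couplings μ ν ∧ ∀ γ' ∈ couplings μ ν, transportCost γ ≤ transportCost γ'}

/-- The Wasserstein-2 distance. -/
def W2 {p : ℕ} (μ ν : P2 p) : ℝ :=
  Real.sqrt (⨅ γ ∈ couplings μ.1 ν.1, transportCost γ).toReal

/-- `ξ ∈ L²(μ)` belongs to the Wasserstein sub-differential of `G` at `μ`:
`G ν ≥ G μ + sup_γ ∫ ⟨ξ x, y - x⟩ dγ(x, y) + o(W₂(μ, ν))`, the supremum being over the optimal
couplings `γ` of `μ` and `ν`. -/
def IsSubgradient {p : ℕ} (G : P2 p → ℝ) (μ : P2 p) (ξ : E p → E p) : Prop :=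
  MemLp ξ 2 μ.1 ∧
    ∀ ε : ℝ, 0 < ε → ∃ δ : ℝ, 0 < δ ∧ ∀ ν : P2 p, W2 μ ν < δ →
      ∀ γ ∈ optimalCouplings μ.1 ν.1,
        G ν ≥ G μ + (∫ z, inner ℝ (ξ z.1) (z.2 - z.1) ∂γ) - ε * W2 μ ν

/-- `ξ` belongs to the Wasserstein super-differential of `G` at `μ`. -/
def IsSupergradient {p : ℕ} (G : P2 p → ℝ) (μ : P2 p) (ξ : E p → E p) : Prop :=
  IsSubgradient (-G) μ (-ξ)

/-- The tangent space of `𝒫₂(ℝᵖ)` at `μ`: the closure in `L²(μ)` of the gradients of smooth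
compactly supported functions. -/
def InTangentSpace {p : ℕ} (μ : P2 p) (ξ : E p → E p) : Prop :=
  MemLp ξ 2 μ.1 ∧
    ∀ ε : ℝ, 0 < ε → ∃ ψ : E p → ℝ, ContDiff ℝ ∞ ψ ∧ HasCompactSupport ψ ∧
      eLpNorm (fun x => ξ x - gradient ψ x) 2 μ.1 < ENNReal.ofReal ε

/-- `ξ` is the Wasserstein gradient of `G` at `μ`: it is a sub- and a super-gradient, and it is
the one that lies in the tangent space at `μ`. -/
def IsWassersteinGradient {p : ℕ} (G : P2 p → ℝ) (μ : P2 p) (ξ : E p → E p) : Prop :=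
  IsSubgradient G μ ξ ∧ IsSupergradient G μ ξ ∧ InTangentSpace μ ξ

/-- The squared maximum mean discrepancy
`∬ k(x, y) d(μ - ν)(x) d(μ - ν)(y)`, expanded by bilinearity. -/
def mmdSq {p : ℕ} (k : E p → E p → ℝ) (μ ν : Measure (E p)) : ℝ :=
  (∫ x, ∫ y, k x y ∂μ ∂μ) - (∫ x, ∫ y, k x y ∂ν ∂μ)
    - (∫ x, ∫ y, k x y ∂μ ∂ν) + (∫ x, ∫ y, k x y ∂ν ∂ν)

/-- The objective `G(μ) = ½ MMD²(μ, T_# μ)`. -/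
def selfMMD {p : ℕ} (k : E p → E p → ℝ) (T : E p → E p) (μ : P2 p) : ℝ :=
  (1 / 2) * mmdSq k μ.1 (μ.1.map T)

/-- The witness function `f_μ = ∫ k(·, y) dμ(y) - ∫ k(·, y) d(T_# μ)(y)`. -/
def witness {p : ℕ} (k : E p → E p → ℝ) (T : E p → E p) (μ : P2 p) (x : E p) : ℝ :=
  (∫ y, k x y ∂μ.1) - ∫ y, k x y ∂(μ.1.map T)

end

/-!
Let `φ(x, y) = k(x, y) - k(x, T y) - k(T x, y) + k(T x, T y)`, a symmetric function. Then the
objective is the interaction energy `G(ν) = ½ ∬ φ d(ν ⊗ ν)`, and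
`∫ φ(x, y) dμ(y) = f_μ(x) - f_μ(T x) =: F(x)`. All functions involved are Lipschitz on balls with a
constant that grows linearly in the radius (`IsQuadLipschitz`), so they grow at most quadratically
and are integrable against measures with a second moment. They need not be `C¹`, and `φ` and `F` are
differentiable only almost everywhere, for `μ ⊗ μ` and `μ`.

*Expansion.* For a coupling `γ` of `μ` and `ν` and two independent pairs `(x, x')`, `(y, y')` with
law `γ`,
`G(ν) - G(μ) = ∫ (F(x') - F(x)) dγ + ½ ∬ (φ(x', y') - φ(x', y) - φ(x, y') + φ(x, y)) dγ dγ`.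
The first term is `∫ ⟨∇F(x), x' - x⟩ dγ + o(W₂)` and the second is `o(W₂)`. Both follow from
`exists_lintegral_taylorRemainder_le`: the first-order remainder of a function that is
differentiable almost everywhere is `o(‖Z' - Z‖_{L²})` in mean, uniformly in the pair of random
points `(Z, Z')` once the law of `Z` is fixed. This holds because the remainder at `z` is at most
`sₙ(z) ‖d‖ + n ‖d‖²`, with slopes `sₙ` (`remainderSlope`) that tend to `0` in `L²`. In the second
term the derivatives of `φ` cancel.

*Tangency.* The mollifications of `F` have derivatives that converge at every point of
differentiability of `F` (`tendsto_fderiv_mollify`), hence `μ`-almost everywhere even if `μ` is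
singular. Cut off at radius of order `n`, they are smooth with compact support and their gradients
grow at most linearly, uniformly in `n`, so they converge to `∇F` in `L²(μ)`
(`inTangentSpace_gradient`).

*Uniqueness.* For small `t` the coupling of `μ` with its image under `x ↦ x + t ∇ψ(x)` is optimal
(`graph_mem_optimalCouplings`). Comparing the sub- and super-gradient inequalities along it shows
that two Wasserstein gradients have the same inner product in `L²(μ)` with every `∇ψ`; as both lie
in the closure of the `∇ψ`, they agree.
-/

/-! ### Functions whose local Lipschitz constant grows linearly -/

/-- `Φ` is Lipschitz on every ball, with a constant growing at most linearly in the radius. -/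
def IsQuadLipschitz {V : Type*} [SeminormedAddCommGroup V] (Φ : V → ℝ) : Prop :=
  ∃ C : ℝ, 0 ≤ C ∧ ∀ z z', |Φ z' - Φ z| ≤ C * (1 + ‖z‖ + ‖z'‖) * ‖z' - z‖

namespace IsQuadLipschitz

section Seminormed

variable {V W : Type*} [SeminormedAddCommGroup V] [SeminormedAddCommGroup W] {Φ Ψ : V → ℝ}

theorem sub (hΦ : IsQuadLipschitz Φ) (hΨ : IsQuadLipschitz Ψ) :
    IsQuadLipschitz (fun z => Φ z - Ψ z) := by
  obtain ⟨C, hC, h⟩ := hΦ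
  obtain ⟨D, hD, h'⟩ := hΨ
  refine ⟨C + D, add_nonneg hC hD, fun z z' => ?_⟩
  calc |Φ z' - Ψ z' - (Φ z - Ψ z)| = |(Φ z' - Φ z) - (Ψ z' - Ψ z)| := by ring_nf
    _ ≤ |Φ z' - Φ z| + |Ψ z' - Ψ z| := abs_sub _ _
    _ ≤ _ := by linarith [h z z', h' z z']

theorem add (hΦ : IsQuadLipschitz Φ) (hΨ : IsQuadLipschitz Ψ) :
    IsQuadLipschitz (fun z => Φ z + Ψ z) := by
  obtain ⟨C, hC, h⟩ := hΦ
  obtain ⟨D, hD, h'⟩ := hΨ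
  refine ⟨C + D, add_nonneg hC hD, fun z z' => ?_⟩
  calc |Φ z' + Ψ z' - (Φ z + Ψ z)| = |(Φ z' - Φ z) + (Ψ z' - Ψ z)| := by ring_nf
    _ ≤ |Φ z' - Φ z| + |Ψ z' - Ψ z| := abs_add_le _ _
    _ ≤ _ := by linarith [h z z', h' z z']

theorem comp_lipschitz (hΦ : IsQuadLipschitz Φ) {S : W → V} {K : NNReal}
    (hS : LipschitzWith K S) : IsQuadLipschitz (fun w => Φ (S w)) := by
  obtain ⟨C, hC, h⟩ := hΦ
  have hS' : ∀ w w', ‖S w' - S w‖ ≤ K * ‖w' - w‖ := fun w w' => hS.norm_sub_le _ _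
  have hgr : ∀ w, ‖S w‖ ≤ ‖S 0‖ + K * ‖w‖ := fun w => by
    have h1 := hS' 0 w
    have h2 := norm_le_norm_add_norm_sub' (S w) (S 0)
    rw [sub_zero] at h1
    linarith
  have hK : (0 : ℝ) ≤ K := K.2
  refine ⟨C * (1 + 2 * ‖S 0‖ + K) * K, by positivity, fun w w' => ?_⟩
  calc |Φ (S w') - Φ (S w)| ≤ C * (1 + ‖S w‖ + ‖S w'‖) * ‖S w' - S w‖ := h _ _
    _ ≤ C * (1 + (‖S 0‖ + K * ‖w‖) + (‖S 0‖ + K * ‖w'‖)) * (K * ‖w' - w‖) := by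
        gcongr
        exacts [hgr w, hgr w', hS' w w']
    _ ≤ C * ((1 + 2 * ‖S 0‖ + K) * (1 + ‖w‖ + ‖w'‖)) * (K * ‖w' - w‖) := by
        gcongr
        nlinarith [norm_nonneg w, norm_nonneg w', norm_nonneg (S 0),
          mul_nonneg (norm_nonneg (S 0)) (norm_nonneg w),
          mul_nonneg (norm_nonneg (S 0)) (norm_nonneg w')]
    _ = _ := by ring

theorem abs_le_of_norm_sub_le_one {C : ℝ} (hC : 0 ≤ C)
    (h : ∀ z z', |Φ z' - Φ z| ≤ C * (1 + ‖z‖ + ‖z'‖) * ‖z' - z‖) {z z' : V}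
    (hz : ‖z' - z‖ ≤ 1) : |Φ z' - Φ z| ≤ C * (2 + 2 * ‖z‖) * ‖z' - z‖ := by
  refine (h z z').trans ?_
  have := norm_le_norm_add_norm_sub' z' z
  exact mul_le_mul_of_nonneg_right (mul_le_mul_of_nonneg_left (by linarith) hC) (norm_nonneg _)

theorem continuous (hΦ : IsQuadLipschitz Φ) : Continuous Φ := by
  obtain ⟨C, hC, h⟩ := hΦ
  rw [continuous_iff_continuousAt]
  intro z
  rw [ContinuousAt, tendsto_iff_norm_sub_tendsto_zero]
  have h0 : Filter.Tendsto (fun z' => C * (1 + ‖z‖ + ‖z'‖) * ‖z' - z‖) (nhds z)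
      (nhds (C * (1 + ‖z‖ + ‖z‖) * ‖z - z‖)) :=
    (by fun_prop : Continuous fun z' => C * (1 + ‖z‖ + ‖z'‖) * ‖z' - z‖).tendsto z
  rw [sub_self, norm_zero, mul_zero] at h0
  exact squeeze_zero (fun _ => norm_nonneg _) (fun z' => h z z') h0

theorem exists_abs_le (hΦ : IsQuadLipschitz Φ) :
    ∃ A : ℝ, 0 ≤ A ∧ ∀ z, |Φ z| ≤ A * (1 + ‖z‖ ^ 2) := by
  obtain ⟨C, hC, h⟩ := hΦ
  refine ⟨|Φ 0| + 2 * C, by positivity, fun z => ?_⟩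
  have h1 := h 0 z
  rw [sub_zero, norm_zero, add_zero] at h1
  have h2 : |Φ z| ≤ |Φ z - Φ 0| + |Φ 0| := by
    simpa using abs_add_le (Φ z - Φ 0) (Φ 0)
  have h3 : C * (1 + ‖z‖) * ‖z‖ ≤ 2 * C * (1 + ‖z‖ ^ 2) := by
    nlinarith [sq_nonneg (‖z‖ - 1), mul_nonneg hC (sq_nonneg (‖z‖ - 1)),
      mul_nonneg hC (sq_nonneg ‖z‖)]
  nlinarith [abs_nonneg (Φ 0), mul_nonneg (abs_nonneg (Φ 0)) (sq_nonneg ‖z‖)]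

theorem integrable [MeasurableSpace V] [OpensMeasurableSpace V] (hΦ : IsQuadLipschitz Φ)
    {m : Measure V} [IsFiniteMeasure m] (hm : Integrable (fun z => ‖z‖ ^ 2) m) :
    Integrable Φ m := by
  obtain ⟨A, hA, h⟩ := hΦ.exists_abs_le
  exact (((integrable_const (1 : ℝ)).add hm).const_mul A).mono'
    hΦ.continuous.measurable.aestronglyMeasurable (.of_forall h)

end Seminormed

section Normed

variable {V : Type*} [NormedAddCommGroup V] [NormedSpace ℝ V] {Φ : V → ℝ}

theorem norm_fderiv_le {C : ℝ} (hC : 0 ≤ C)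
    (h : ∀ z z', |Φ z' - Φ z| ≤ C * (1 + ‖z‖ + ‖z'‖) * ‖z' - z‖) (z : V) :
    ‖fderiv ℝ Φ z‖ ≤ C * (2 + 2 * ‖z‖) := by
  refine norm_fderiv_le_of_lip' ℝ (by positivity) ?_
  filter_upwards [Metric.closedBall_mem_nhds z one_pos] with z' hz'
  exact abs_le_of_norm_sub_le_one hC h (mem_closedBall_iff_norm.1 hz')

end Normed

end IsQuadLipschitz

/-! ### The first-order remainder in mean -/

section Remainder

variable {V : Type*} [NormedAddCommGroup V] [NormedSpace ℝ V]

/-- The first-order Taylor remainder of `Φ` at `z` for the increment `d`. -/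
noncomputable def taylorRemainder (Φ : V → ℝ) (z d : V) : ℝ :=
  Φ (z + d) - Φ z - fderiv ℝ Φ z d

theorem abs_taylorRemainder_le {Φ : V → ℝ} {C : ℝ} (hC : 0 ≤ C)
    (h : ∀ z z', |Φ z' - Φ z| ≤ C * (1 + ‖z‖ + ‖z'‖) * ‖z' - z‖) (z d : V) :
    |taylorRemainder Φ z d| ≤ (C * (3 + 4 * ‖z‖) + C * ‖d‖) * ‖d‖ := by
  have h1 := h z (z + d)
  rw [add_sub_cancel_left] at h1
  have h2 : |fderiv ℝ Φ z d| ≤ C * (2 + 2 * ‖z‖) * ‖d‖ :=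
    ((fderiv ℝ Φ z).le_opNorm d).trans
      (mul_le_mul_of_nonneg_right (IsQuadLipschitz.norm_fderiv_le hC h z) (norm_nonneg d))
  have h3 : C * (1 + ‖z‖ + ‖z + d‖) * ‖d‖ ≤ C * (1 + ‖z‖ + (‖z‖ + ‖d‖)) * ‖d‖ := by
    gcongr
    exact norm_add_le z d
  calc |taylorRemainder Φ z d| ≤ |Φ (z + d) - Φ z| + |fderiv ℝ Φ z d| := abs_sub _ _
    _ ≤ _ := by linarith

variable [TopologicalSpace.SeparableSpace V]

open TopologicalSpace in
/-- The least `s` with `|R z d| ≤ s ‖d‖ + n ‖d‖²` for all `d`, where `R` is the first-order Taylor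
remainder of `Φ`. The supremum runs over a countable dense set of `d` only, which makes it
measurable in `z`; the truncated subtraction and `0 / 0 = 0` in `ℝ≥0∞` are intended. -/
noncomputable def remainderSlope (Φ : V → ℝ) (n : ℕ) (z : V) : ℝ≥0∞ :=
  ⨆ j : ℕ, (‖taylorRemainder Φ z (denseSeq V j)‖ₑ - n * ‖denseSeq V j‖ₑ ^ 2) / ‖denseSeq V j‖ₑ

theorem measurable_remainderSlope [MeasurableSpace V] [BorelSpace V] {Φ : V → ℝ}
    (hΦ : Continuous Φ) (n : ℕ) : Measurable (remainderSlope Φ n) := by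
  refine .iSup fun j => ?_
  have h1 : Measurable fun z => taylorRemainder Φ z (TopologicalSpace.denseSeq V j) :=
    (((hΦ.comp (continuous_id.add continuous_const)).measurable).sub hΦ.measurable).sub
      (measurable_fderiv_apply_const ℝ Φ _)
  exact (h1.enorm.sub_const _).div_const _

theorem enorm_taylorRemainder_le {Φ : V → ℝ} (hΦ : Continuous Φ) (n : ℕ) (z d : V) :
    ‖taylorRemainder Φ z d‖ₑ ≤ remainderSlope Φ n z * ‖d‖ₑ + n * ‖d‖ₑ ^ 2 := by
  rcases eq_or_ne d 0 with rfl | hd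
  · simp [taylorRemainder]
  by_cases hs : remainderSlope Φ n z = ⊤
  · rw [hs, ENNReal.top_mul (enorm_ne_zero.2 hd)]
    simp
  have hcl : IsClosed {d | ‖taylorRemainder Φ z d‖ₑ ≤
      remainderSlope Φ n z * ‖d‖ₑ + n * ‖d‖ₑ ^ 2} := by
    refine isClosed_le ?_ ?_
    · exact Continuous.enorm (by unfold taylorRemainder; fun_prop)
    · exact ((ENNReal.continuous_const_mul hs).comp continuous_enorm).add
        ((ENNReal.continuous_const_mul (by simp)).comp
          ((ENNReal.continuous_pow 2).comp continuous_enorm))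
  refine (TopologicalSpace.denseRange_denseSeq V).induction_on (p := fun d =>
    ‖taylorRemainder Φ z d‖ₑ ≤ remainderSlope Φ n z * ‖d‖ₑ + n * ‖d‖ₑ ^ 2) d hcl fun j => ?_
  set e := TopologicalSpace.denseSeq V j with he
  rcases eq_or_ne e 0 with h0 | h0
  · simp [h0, taylorRemainder]
  have h1 : (‖taylorRemainder Φ z e‖ₑ - n * ‖e‖ₑ ^ 2) / ‖e‖ₑ ≤ remainderSlope Φ n z :=
    le_iSup (fun j => (‖taylorRemainder Φ z (TopologicalSpace.denseSeq V j)‖ₑ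
      - n * ‖TopologicalSpace.denseSeq V j‖ₑ ^ 2) / ‖TopologicalSpace.denseSeq V j‖ₑ) j
  rw [ENNReal.div_le_iff (by simpa using h0) (by simp)] at h1
  exact tsub_le_iff_right.1 h1

/-- A pointwise bound on the remainder passes to the slope. -/
theorem remainderSlope_le {Φ : V → ℝ} {n : ℕ} {z : V} {s : ℝ} (hs : 0 ≤ s)
    (h : ∀ d, |taylorRemainder Φ z d| ≤ s * ‖d‖ + n * ‖d‖ ^ 2) :
    remainderSlope Φ n z ≤ ENNReal.ofReal s := by
  refine iSup_le fun j => ?_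
  refine ENNReal.div_le_of_le_mul ?_
  rw [tsub_le_iff_right]
  set e := TopologicalSpace.denseSeq V j
  have h1 := ENNReal.ofReal_le_ofReal (h e)
  rwa [ENNReal.ofReal_add (by positivity) (by positivity), ENNReal.ofReal_mul hs,
    ENNReal.ofReal_mul (by positivity), ENNReal.ofReal_pow (by positivity), ofReal_norm,
    ENNReal.ofReal_natCast, ← Real.norm_eq_abs, ofReal_norm] at h1

/-- For increments `‖d‖ < δ` differentiability makes the remainder small relative to `‖d‖`; for
`‖d‖ ≥ δ` the term `n ‖d‖²` eventually dominates it. -/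
theorem tendsto_remainderSlope {Φ : V → ℝ} (hΦ : IsQuadLipschitz Φ) {z : V}
    (hz : DifferentiableAt ℝ Φ z) :
    Filter.Tendsto (fun n => remainderSlope Φ n z) Filter.atTop (nhds 0) := by
  obtain ⟨C, hC, h⟩ := hΦ
  rw [ENNReal.tendsto_nhds_zero]
  intro ε hε
  obtain ⟨η, hη, hηε⟩ : ∃ η : ℝ, 0 < η ∧ ENNReal.ofReal η ≤ ε := by
    rcases eq_or_ne ε ⊤ with rfl | hε'
    · exact ⟨1, one_pos, le_top⟩
    · exact ⟨ε.toReal, ENNReal.toReal_pos hε.ne' hε', ENNReal.ofReal_toReal_le⟩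
  obtain ⟨δ, hδ, hδ'⟩ : ∃ δ > 0, ∀ d : V, ‖d‖ < δ → |taylorRemainder Φ z d| ≤ η * ‖d‖ := by
    have := (hasFDerivAt_iff_isLittleO_nhds_zero.1 hz.hasFDerivAt).def hη
    obtain ⟨δ, hδ, hb⟩ := Metric.eventually_nhds_iff.1 this
    exact ⟨δ, hδ, fun d hd => hb (by simpa using hd)⟩
  obtain ⟨N, hN⟩ := exists_nat_ge (C * (3 + 4 * ‖z‖) / δ + C)
  filter_upwards [Filter.eventually_ge_atTop N] with n hn
  refine (remainderSlope_le hη.le fun d => ?_).trans hηε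
  rcases lt_or_ge ‖d‖ δ with hd | hd
  · have := hδ' d hd
    have : (0 : ℝ) ≤ n * ‖d‖ ^ 2 := by positivity
    linarith [hδ' d hd]
  · have h1 := abs_taylorRemainder_le hC h z d
    have hn' : (N : ℝ) ≤ n := by exact_mod_cast hn
    have h2 : C * (3 + 4 * ‖z‖) ≤ (n - C) * ‖d‖ := by
      have h3 : C * (3 + 4 * ‖z‖) / δ ≤ n - C := by linarith
      have h4 : 0 ≤ C * (3 + 4 * ‖z‖) / δ := by positivity
      calc C * (3 + 4 * ‖z‖) = C * (3 + 4 * ‖z‖) / δ * δ := by field_simp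
        _ ≤ (n - C) * ‖d‖ := mul_le_mul h3 hd hδ.le (h4.trans h3)
    nlinarith [mul_le_mul_of_nonneg_right h2 (norm_nonneg d), mul_nonneg hη.le (norm_nonneg d)]

variable [MeasurableSpace V] [BorelSpace V]

/-- Dominated convergence: for `n` above the growth constant the slopes are at most linear in `‖z‖`. -/
theorem tendsto_lintegral_remainderSlope_sq {Φ : V → ℝ} (hΦ : IsQuadLipschitz Φ) {m : Measure V}
    [IsFiniteMeasure m] (hm : Integrable (fun z => ‖z‖ ^ 2) m)
    (hd : ∀ᵐ z ∂m, DifferentiableAt ℝ Φ z) :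
    Filter.Tendsto (fun n => ∫⁻ z, remainderSlope Φ n z ^ 2 ∂m) Filter.atTop (nhds 0) := by
  obtain ⟨C, hC, h⟩ := id hΦ
  obtain ⟨N, hN⟩ := exists_nat_ge C
  rw [← Filter.tendsto_add_atTop_iff_nat N, ← lintegral_zero (μ := m)]
  refine tendsto_lintegral_of_dominated_convergence
    (fun z => ENNReal.ofReal (C * (3 + 4 * ‖z‖)) ^ 2)
    (fun n => (measurable_remainderSlope hΦ.continuous _).pow_const 2) (fun n => .of_forall ?_) ?_ ?_
  · intro z
    refine pow_le_pow_left' ?_ 2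
    refine remainderSlope_le (by positivity) fun d => ?_
    have h1 := abs_taylorRemainder_le hC h z d
    have h2 : C ≤ ((n + N : ℕ) : ℝ) := by
      push_cast
      linarith [(Nat.cast_nonneg n : (0 : ℝ) ≤ n)]
    nlinarith [mul_le_mul_of_nonneg_right h2 (sq_nonneg ‖d‖)]
  · have hint : Integrable (fun z => C ^ 2 * (18 + 32 * ‖z‖ ^ 2)) m :=
      ((integrable_const (18 : ℝ)).add (hm.const_mul 32)).const_mul (C ^ 2)
    refine ((lintegral_mono fun z => ?_).trans_lt hint.lintegral_lt_top).ne
    rw [← ENNReal.ofReal_pow (by positivity)]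
    refine ENNReal.ofReal_le_ofReal ?_
    rw [mul_pow]
    refine mul_le_mul_of_nonneg_left ?_ (sq_nonneg C)
    nlinarith [sq_nonneg (3 - 4 * ‖z‖)]
  · filter_upwards [hd] with z hz
    have := ((ENNReal.continuous_pow 2).tendsto 0).comp (tendsto_remainderSlope hΦ hz)
    rw [zero_pow two_ne_zero] at this
    exact this.comp (Filter.tendsto_add_atTop_nat N)

/-- If `Φ` is differentiable at almost every value of a random variable `Z`, the remainder of the
first-order expansion of `Φ` from `Z` to `Z'` is `o(‖Z' - Z‖_{L²})` in mean, uniformly over all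
pairs `(Z, Z')` for which `Z` has the law `m`. -/
theorem exists_lintegral_taylorRemainder_le {Φ : V → ℝ} (hΦ : IsQuadLipschitz Φ) {m : Measure V}
    [IsFiniteMeasure m] (hm : Integrable (fun z => ‖z‖ ^ 2) m)
    (hd : ∀ᵐ z ∂m, DifferentiableAt ℝ Φ z) {ε : ℝ} (hε : 0 < ε) :
    ∃ δ : ℝ, 0 < δ ∧ ∀ {Ω : Type} [MeasurableSpace Ω] (P : Measure Ω) (Z D : Ω → V) (W : ℝ),
      Measurable Z → Measurable D → P.map Z = m → 0 ≤ W → W < δ →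
      ∫⁻ t, ‖D t‖ₑ ^ 2 ∂P ≤ ENNReal.ofReal (W ^ 2) →
      ∫⁻ t, ‖taylorRemainder Φ (Z t) (D t)‖ₑ ∂P ≤ ENNReal.ofReal (ε * W) := by
  have hε2 : (0 : ℝ) < (ε / 2) ^ 2 := by positivity
  obtain ⟨n, hn⟩ := ((ENNReal.tendsto_nhds_zero.1
    (tendsto_lintegral_remainderSlope_sq hΦ hm hd)) _ (ENNReal.ofReal_pos.2 hε2)).exists
  refine ⟨ε / 2 / (n + 1), by positivity, fun {Ω} _ P Z D W hZ hD hlaw hW hWδ hDW => ?_⟩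
  have hsm := measurable_remainderSlope hΦ.continuous n
  have hcs : ∫⁻ t, remainderSlope Φ n (Z t) * ‖D t‖ₑ ∂P ≤ ENNReal.ofReal (ε / 2 * W) := by
    refine (ENNReal.lintegral_mul_le_Lp_mul_Lq P Real.HolderConjugate.two_two
      (hsm.comp hZ).aemeasurable hD.enorm.aemeasurable).trans ?_
    rw [ENNReal.ofReal_mul (by positivity)]
    have hroot : ∀ {a : ℝ≥0∞} {b : ℝ}, 0 ≤ b → a ≤ ENNReal.ofReal (b ^ 2) →
        a ^ (1 / 2 : ℝ) ≤ ENNReal.ofReal b := fun {a b} hb hab => by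
      refine (ENNReal.rpow_le_rpow hab (by norm_num)).trans_eq ?_
      rw [ENNReal.ofReal_rpow_of_nonneg (by positivity) (by norm_num), ← Real.sqrt_eq_rpow,
        Real.sqrt_sq hb]
    refine mul_le_mul' (hroot (by positivity) ?_) (hroot hW ?_)
    · simp only [ENNReal.rpow_two, Function.comp_apply]
      rw [← lintegral_map (f := fun z => remainderSlope Φ n z ^ 2) (hsm.pow_const 2) hZ, hlaw]
      exact hn
    · simpa only [ENNReal.rpow_two] using hDW
  calc ∫⁻ t, ‖taylorRemainder Φ (Z t) (D t)‖ₑ ∂P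
      ≤ ∫⁻ t, (remainderSlope Φ n (Z t) * ‖D t‖ₑ + n * ‖D t‖ₑ ^ 2) ∂P :=
        lintegral_mono fun t => enorm_taylorRemainder_le hΦ.continuous n _ _
    _ = ∫⁻ t, remainderSlope Φ n (Z t) * ‖D t‖ₑ ∂P + n * ∫⁻ t, ‖D t‖ₑ ^ 2 ∂P := by
        rw [lintegral_add_left (by exact (hsm.comp hZ).mul hD.enorm),
          lintegral_const_mul _ (hD.enorm.pow_const 2)]
    _ ≤ ENNReal.ofReal (ε / 2 * W) + ENNReal.ofReal n * ENNReal.ofReal (W ^ 2) := by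
        rw [ENNReal.ofReal_natCast]
        gcongr
    _ ≤ ENNReal.ofReal (ε * W) := by
        rw [← ENNReal.ofReal_mul (by positivity), ← ENNReal.ofReal_add (by positivity)
          (by positivity)]
        refine ENNReal.ofReal_le_ofReal ?_
        rw [lt_div_iff₀ (by positivity)] at hWδ
        nlinarith

end Remainder

section RemainderMean

variable {V : Type*} [NormedAddCommGroup V] [NormedSpace ℝ V] [FiniteDimensional ℝ V]
  [MeasurableSpace V] [BorelSpace V]

theorem measurable_taylorRemainder {Φ : V → ℝ} (hΦ : Continuous Φ) {Ω : Type*} [MeasurableSpace Ω]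
    {Z D : Ω → V} (hZ : Measurable Z) (hD : Measurable D) :
    Measurable (fun t => taylorRemainder Φ (Z t) (D t)) := by
  have : ProperSpace V := FiniteDimensional.proper ℝ V
  have h := (isBoundedBilinearMap_apply (𝕜 := ℝ) (E := V) (F := ℝ)).continuous.measurable.comp
    (((measurable_fderiv ℝ Φ).comp hZ).prodMk hD)
  exact ((hΦ.measurable.comp (hZ.add hD)).sub (hΦ.measurable.comp hZ)).sub h

theorem exists_abs_integral_taylorRemainder_le {Φ : V → ℝ} (hΦ : IsQuadLipschitz Φ) {m : Measure V}
    [IsFiniteMeasure m] (hm : Integrable (fun z => ‖z‖ ^ 2) m)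
    (hd : ∀ᵐ z ∂m, DifferentiableAt ℝ Φ z) {ε : ℝ} (hε : 0 < ε) :
    ∃ δ : ℝ, 0 < δ ∧ ∀ {Ω : Type} [MeasurableSpace Ω] (P : Measure Ω) (Z D : Ω → V) (W : ℝ),
      Measurable Z → Measurable D → P.map Z = m → 0 ≤ W → W < δ →
      ∫⁻ t, ‖D t‖ₑ ^ 2 ∂P ≤ ENNReal.ofReal (W ^ 2) →
      Integrable (fun t => taylorRemainder Φ (Z t) (D t)) P ∧
        |∫ t, taylorRemainder Φ (Z t) (D t) ∂P| ≤ ε * W := by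
  have : ProperSpace V := FiniteDimensional.proper ℝ V
  obtain ⟨δ, hδ, h⟩ := exists_lintegral_taylorRemainder_le hΦ hm hd hε
  refine ⟨δ, hδ, fun {Ω} _ P Z D W hZ hD hlaw hW hWδ hDW => ?_⟩
  have h1 := h P Z D W hZ hD hlaw hW hWδ hDW
  refine ⟨⟨(measurable_taylorRemainder hΦ.continuous hZ hD).aestronglyMeasurable,
    h1.trans_lt ENNReal.ofReal_lt_top⟩, ?_⟩
  have h2 := (enorm_integral_le_lintegral_enorm
    (fun t => taylorRemainder Φ (Z t) (D t)) (μ := P)).trans h1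
  rw [← ofReal_norm] at h2
  exact (ENNReal.ofReal_le_ofReal_iff (by positivity)).1 h2

end RemainderMean

/-! ### Integrating out one variable -/

section Partial

variable {V W : Type*} [NormedAddCommGroup V] [NormedAddCommGroup W]

theorem IsQuadLipschitz.section_left {K : V × W → ℝ} (hK : IsQuadLipschitz K) (x : V) :
    IsQuadLipschitz (fun y => K (x, y)) := by
  obtain ⟨C, hC, h⟩ := hK
  refine ⟨C * (1 + 2 * ‖x‖), by positivity, fun y y' => ?_⟩
  have hn : ∀ y : W, ‖(x, y)‖ ≤ ‖x‖ + ‖y‖ := fun y => by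
    rw [Prod.norm_mk]
    exact max_le_add_of_nonneg (norm_nonneg _) (norm_nonneg _)
  calc |K (x, y') - K (x, y)| ≤ C * (1 + ‖(x, y)‖ + ‖(x, y')‖) * ‖(x, y') - (x, y)‖ := h _ _
    _ ≤ C * (1 + (‖x‖ + ‖y‖) + (‖x‖ + ‖y'‖)) * ‖y' - y‖ := by
        rw [Prod.mk_sub_mk, sub_self, Prod.norm_mk (0 : V), norm_zero, max_eq_right (norm_nonneg _)]
        gcongr
        exacts [hn y, hn y']
    _ ≤ C * ((1 + 2 * ‖x‖) * (1 + ‖y‖ + ‖y'‖)) * ‖y' - y‖ := by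
        gcongr
        nlinarith [mul_nonneg (norm_nonneg x) (norm_nonneg y),
          mul_nonneg (norm_nonneg x) (norm_nonneg y')]
    _ = _ := by ring

theorem abs_section_right_sub_le {K : V × W → ℝ} {C : ℝ} (hC : 0 ≤ C)
    (h : ∀ z z', |K z' - K z| ≤ C * (1 + ‖z‖ + ‖z'‖) * ‖z' - z‖) (x x' : V) (y : W) :
    |K (x', y) - K (x, y)| ≤ C * (1 + ‖x‖ + ‖x'‖ + 2 * ‖y‖) * ‖x' - x‖ := by
  have hn : ∀ x : V, ‖(x, y)‖ ≤ ‖x‖ + ‖y‖ := fun x => by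
    rw [Prod.norm_mk]
    exact max_le_add_of_nonneg (norm_nonneg _) (norm_nonneg _)
  refine (h _ _).trans ?_
  rw [Prod.mk_sub_mk, sub_self, Prod.norm_mk _ (0 : W), norm_zero, max_eq_left (norm_nonneg _)]
  refine mul_le_mul_of_nonneg_right (mul_le_mul_of_nonneg_left ?_ hC) (norm_nonneg _)
  linarith [hn x, hn x']

variable [MeasurableSpace W] [BorelSpace W] {ν : Measure W}

theorem integrable_norm_of_sq [IsFiniteMeasure ν] (hν : Integrable (fun y => ‖y‖ ^ 2) ν) :
    Integrable (fun y => ‖y‖) ν := by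
  refine ((integrable_const (1 : ℝ)).add hν).mono' continuous_norm.measurable.aestronglyMeasurable
    (.of_forall fun y => ?_)
  rw [norm_norm, Pi.add_apply]
  nlinarith [sq_nonneg (‖y‖ - 1), norm_nonneg y]

theorem IsQuadLipschitz.integral_right [IsFiniteMeasure ν] {K : V × W → ℝ}
    (hK : IsQuadLipschitz K) (hν : Integrable (fun y => ‖y‖ ^ 2) ν) :
    IsQuadLipschitz (fun x => ∫ y, K (x, y) ∂ν) := by
  have hint := fun x => (hK.section_left x).integrable hν
  obtain ⟨C, hC, h⟩ := hK
  have h1 := integrable_norm_of_sq hν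
  have hI : 0 ≤ ∫ y, ‖y‖ ∂ν := integral_nonneg fun _ => norm_nonneg _
  refine ⟨C * (ν.real Set.univ + 2 * ∫ y, ‖y‖ ∂ν), by positivity, fun x x' => ?_⟩
  have hb : Integrable (fun y => C * (1 + ‖x‖ + ‖x'‖ + 2 * ‖y‖) * ‖x' - x‖) ν :=
    (((integrable_const _).add (h1.const_mul 2)).const_mul C).mul_const _
  calc |∫ y, K (x', y) ∂ν - ∫ y, K (x, y) ∂ν|
      = |∫ y, (K (x', y) - K (x, y)) ∂ν| := by rw [integral_sub (hint x') (hint x)]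
    _ ≤ ∫ y, C * (1 + ‖x‖ + ‖x'‖ + 2 * ‖y‖) * ‖x' - x‖ ∂ν :=
        norm_integral_le_of_norm_le (f := fun y => K (x', y) - K (x, y)) hb (.of_forall fun y => abs_section_right_sub_le hC h x x' y)
    _ = C * ((1 + ‖x‖ + ‖x'‖) * ν.real Set.univ + 2 * ∫ y, ‖y‖ ∂ν) * ‖x' - x‖ := by
        rw [integral_mul_const, integral_const_mul, integral_add (integrable_const _)
          (h1.const_mul 2), integral_const, integral_const_mul, smul_eq_mul,
          mul_comm (ν.real Set.univ)]
    _ ≤ C * ((ν.real Set.univ + 2 * ∫ y, ‖y‖ ∂ν) * (1 + ‖x‖ + ‖x'‖)) * ‖x' - x‖ := by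
        refine mul_le_mul_of_nonneg_right (mul_le_mul_of_nonneg_left ?_ hC) (norm_nonneg _)
        nlinarith [mul_nonneg hI (norm_nonneg x), mul_nonneg hI (norm_nonneg x')]
    _ = _ := by ring

/-- Differentiation under the integral sign, with the integrable Lipschitz constant of
`K(·, y)` near `x` as dominating function. -/
theorem IsQuadLipschitz.differentiableAt_integral_right [NormedSpace ℝ V] [FiniteDimensional ℝ V]
    [SecondCountableTopology W]
    [IsFiniteMeasure ν] {K : V × W → ℝ} (hK : IsQuadLipschitz K)
    (hν : Integrable (fun y => ‖y‖ ^ 2) ν) {x : V}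
    (hd : ∀ y, DifferentiableAt ℝ (fun x' => K (x', y)) x) :
    DifferentiableAt ℝ (fun x' => ∫ y, K (x', y) ∂ν) x := by
  have hint := fun x => (hK.section_left x).integrable hν
  have hcont := hK.continuous
  obtain ⟨C, hC, h⟩ := hK
  have h1 := integrable_norm_of_sq hν
  have hmeas : AEStronglyMeasurable (fun y => fderiv ℝ (fun x' => K (x', y)) x) ν := by
    borelize V
    have hc : Continuous (Function.uncurry fun (y : W) (x' : V) => K (x', y)) :=
      hcont.comp continuous_swap
    have := (measurable_fderiv_with_param ℝ hc).comp
      (measurable_id.prodMk (measurable_const (a := x)) : Measurable fun y : W => (y, x))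
    exact this.aestronglyMeasurable
  have hb : Integrable (fun y => C * (3 + 2 * ‖x‖ + 2 * ‖y‖)) ν :=
    ((integrable_const _).add (h1.const_mul 2)).const_mul C
  refine (hasFDerivAt_integral_of_dominated_loc_of_lip (s := Metric.ball x 1)
    (F := fun x' y => K (x', y)) (Metric.ball_mem_nhds x one_pos)
    (.of_forall fun x' => (hint x').aestronglyMeasurable) (hint x) hmeas
    (.of_forall fun y => ?_) hb (.of_forall fun y => (hd y).hasFDerivAt)).2.differentiableAt
  refine LipschitzOnWith.of_dist_le_mul fun a ha b hb => ?_
  rw [Real.dist_eq, dist_eq_norm, Real.coe_nnabs,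
    abs_of_nonneg (by positivity : 0 ≤ C * (3 + 2 * ‖x‖ + 2 * ‖y‖))]
  refine (abs_section_right_sub_le hC h b a y).trans ?_
  have hball : ∀ c ∈ Metric.ball x 1, ‖c‖ ≤ ‖x‖ + 1 := fun c hc => by
    have := norm_le_norm_add_norm_sub' c x
    linarith [(mem_ball_iff_norm.1 hc).le]
  refine mul_le_mul_of_nonneg_right (mul_le_mul_of_nonneg_left ?_ hC) (norm_nonneg _)
  linarith [hball a ha, hball b hb]

variable [MeasurableSpace V] [BorelSpace V] {μ : Measure V}

theorem integrable_norm_sq_prod [IsFiniteMeasure μ] [IsFiniteMeasure ν]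
    [SecondCountableTopologyEither V W]
    (hμ : Integrable (fun x => ‖x‖ ^ 2) μ) (hν : Integrable (fun y => ‖y‖ ^ 2) ν) :
    Integrable (fun z : V × W => ‖z‖ ^ 2) (μ.prod ν) := by
  refine ((hμ.comp_fst ν).add (hν.comp_snd μ)).mono'
    (continuous_norm.pow 2).measurable.aestronglyMeasurable (.of_forall fun z => ?_)
  rw [Real.norm_of_nonneg (by positivity), Pi.add_apply]
  rcases max_choice ‖z.1‖ ‖z.2‖ with hz | hz <;> rw [Prod.norm_def, hz] <;>
    nlinarith [sq_nonneg ‖z.1‖, sq_nonneg ‖z.2‖]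

end Partial

/-! ### Kernels with a gradient of linear growth -/

section Kernel

variable {p : ℕ}

theorem IsP2.integrable_norm_sq {μ : Measure (E p)} (hμ : IsP2 μ) :
    Integrable (fun x => ‖x‖ ^ 2) μ := by
  refine ⟨(continuous_norm.pow 2).measurable.aestronglyMeasurable, ?_⟩
  simpa [HasFiniteIntegral] using hμ.2

instance P2.isProbabilityMeasure (μ : P2 p) : IsProbabilityMeasure μ.1 := μ.2.1

theorem isP2_of_integrable {μ : Measure (E p)} [IsProbabilityMeasure μ]
    (h : Integrable (fun x => ‖x‖ ^ 2) μ) : IsP2 μ := by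
  refine ⟨inferInstance, ?_⟩
  simpa [HasFiniteIntegral] using h.2

theorem IsP2.map_lipschitz {ν : Measure (E p)} (hν : IsP2 ν) {T : E p → E p} {M : NNReal}
    (hT : LipschitzWith M T) : IsP2 (ν.map T) := by
  have := hν.1
  have : IsProbabilityMeasure (ν.map T) :=
    Measure.isProbabilityMeasure_map hT.continuous.measurable.aemeasurable
  refine isP2_of_integrable ?_
  rw [integrable_map_measure (by fun_prop)
    hT.continuous.measurable.aemeasurable]
  have hb : Integrable (fun x => 2 * ‖T 0‖ ^ 2 + 2 * M ^ 2 * ‖x‖ ^ 2) ν :=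
    (integrable_const _).add (hν.integrable_norm_sq.const_mul _)
  refine hb.mono' ((continuous_norm.comp hT.continuous).pow 2).measurable.aestronglyMeasurable
    (.of_forall fun x => ?_)
  have h1 := hT.norm_sub_le x 0
  have h2 := norm_le_norm_add_norm_sub' (T x) (T 0)
  rw [sub_zero] at h1
  have h3 : ‖T x‖ ≤ ‖T 0‖ + M * ‖x‖ := by linarith
  simp only [Function.comp_apply, norm_pow, norm_norm]
  calc ‖T x‖ ^ 2 ≤ (‖T 0‖ + M * ‖x‖) ^ 2 := by gcongr
    _ ≤ _ := by nlinarith [sq_nonneg (‖T 0‖ - M * ‖x‖)]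

/-- The mean value inequality in each variable; symmetry carries the gradient bound over to the
second one. -/
theorem isQuadLipschitz_kernel {k : E p → E p → ℝ} (hk_symm : ∀ x y, k x y = k y x)
    (hk_diff : Differentiable ℝ (fun z : E p × E p => k z.1 z.2))
    (hk_growth : ∃ C : ℝ, ∀ x y, ‖gradient (fun x' => k x' y) x‖ ≤ C * (1 + ‖x‖ + ‖y‖)) :
    IsQuadLipschitz (fun z : E p × E p => k z.1 z.2) := by
  obtain ⟨C, hC'⟩ := hk_growth
  have hC : 0 ≤ C := by
    have := (norm_nonneg _).trans (hC' 0 0)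
    simpa using this
  have hd : ∀ y, Differentiable ℝ (fun x => k x y) := fun y =>
    hk_diff.comp (differentiable_id.prodMk (differentiable_const y))
  have hle : ∀ x x' y, |k x' y - k x y| ≤ C * (1 + ‖x‖ + ‖x'‖ + ‖y‖) * ‖x' - x‖ := by
    intro x x' y
    refine (convex_closedBall (0 : E p) (‖x‖ + ‖x'‖)).norm_image_sub_le_of_norm_fderiv_le
      (𝕜 := ℝ) (f := fun x => k x y) (fun z _ => hd y z) (fun z hz => ?_) ?_ ?_
    · have h1 := hC' z y
      rw [← toDual_gradient, LinearIsometryEquiv.norm_map]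
      refine h1.trans (mul_le_mul_of_nonneg_left ?_ hC)
      linarith [mem_closedBall_zero_iff.1 hz]
    · simp
    · simp
  refine ⟨3 * C, by positivity, fun z z' => ?_⟩
  have h1 := hle z.1 z'.1 z.2
  have h2 := hle z.2 z'.2 z'.1
  rw [hk_symm z'.2 z'.1, hk_symm z.2 z'.1] at h2
  have n1 := norm_fst_le z
  have n2 := norm_snd_le z
  have n1' := norm_fst_le z'
  have n2' := norm_snd_le z'
  have d1 := norm_fst_le (z' - z)
  have d2 := norm_snd_le (z' - z)
  have e1 : C * (1 + ‖z.1‖ + ‖z'.1‖ + ‖z.2‖) * ‖z'.1 - z.1‖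
      ≤ C * (1 + ‖z‖ + ‖z'‖ + ‖z‖) * ‖z' - z‖ := by
    gcongr
    exact d1
  have e2 : C * (1 + ‖z.2‖ + ‖z'.2‖ + ‖z'.1‖) * ‖z'.2 - z.2‖
      ≤ C * (1 + ‖z‖ + ‖z'‖ + ‖z'‖) * ‖z' - z‖ := by
    gcongr
    exact d2
  have e3 : 0 ≤ C * (1 + ‖z‖ + ‖z'‖) * ‖z' - z‖ := by positivity
  have e4 : 0 ≤ C * ‖z' - z‖ := by positivity
  calc |k z'.1 z'.2 - k z.1 z.2|
      = |(k z'.1 z'.2 - k z'.1 z.2) + (k z'.1 z.2 - k z.1 z.2)| := by ring_nf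
    _ ≤ |k z'.1 z'.2 - k z'.1 z.2| + |k z'.1 z.2 - k z.1 z.2| := abs_add_le _ _
    _ ≤ _ := by nlinarith

end Kernel

/-! ### Couplings -/

section Coupling

variable {p : ℕ}

theorem isProbabilityMeasure_of_mem_couplings {μ ν : P2 p} {γ : Measure (E p × E p)}
    (h : γ ∈ couplings μ.1 ν.1) : IsProbabilityMeasure γ := by
  refine ⟨?_⟩
  have h1 : γ.map Prod.fst Set.univ = 1 := by rw [h.1]; exact measure_univ
  rwa [Measure.map_apply measurable_fst MeasurableSet.univ, Set.preimage_univ] at h1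

theorem transportCost_lt_top {μ ν : P2 p} {γ : Measure (E p × E p)}
    (h : γ ∈ couplings μ.1 ν.1) : transportCost γ < ⊤ := by
  have h1 : ∫⁻ z, ‖z.1‖ₑ ^ 2 ∂γ < ⊤ := by
    rw [← lintegral_map (f := fun x : E p => ‖x‖ₑ ^ 2) (by fun_prop) measurable_fst, h.1]
    exact μ.2.2
  have h2 : ∫⁻ z, ‖z.2‖ₑ ^ 2 ∂γ < ⊤ := by
    rw [← lintegral_map (f := fun x : E p => ‖x‖ₑ ^ 2) (by fun_prop) measurable_snd, h.2]
    exact ν.2.2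
  have h3 : ∀ z : E p × E p, ‖z.1 - z.2‖ₑ ^ 2 ≤ 2 * ‖z.1‖ₑ ^ 2 + 2 * ‖z.2‖ₑ ^ 2 := fun z => by
    simp only [← ofReal_norm]
    rw [← ENNReal.ofReal_pow (norm_nonneg _), ← ENNReal.ofReal_pow (norm_nonneg _),
      ← ENNReal.ofReal_pow (norm_nonneg _)]
    have h4 : ‖z.1 - z.2‖ ^ 2 ≤ 2 * ‖z.1‖ ^ 2 + 2 * ‖z.2‖ ^ 2 :=
      calc ‖z.1 - z.2‖ ^ 2 ≤ (‖z.1‖ + ‖z.2‖) ^ 2 := by gcongr; exact norm_sub_le _ _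
        _ ≤ _ := by nlinarith [sq_nonneg (‖z.1‖ - ‖z.2‖)]
    refine (ENNReal.ofReal_le_ofReal h4).trans_eq ?_
    rw [ENNReal.ofReal_add (by positivity) (by positivity), ENNReal.ofReal_mul (by norm_num),
      ENNReal.ofReal_mul (by norm_num), ENNReal.ofReal_ofNat]
  refine (lintegral_mono h3).trans_lt ?_
  rw [lintegral_add_left (by fun_prop), lintegral_const_mul _ (by fun_prop),
    lintegral_const_mul _ (by fun_prop)]
  exact ENNReal.add_lt_top.2 ⟨ENNReal.mul_lt_top (by simp) h1, ENNReal.mul_lt_top (by simp) h2⟩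

theorem W2_nonneg (μ ν : P2 p) : 0 ≤ W2 μ ν := Real.sqrt_nonneg _

theorem transportCost_eq_of_mem_optimalCouplings {μ ν : P2 p} {γ : Measure (E p × E p)}
    (h : γ ∈ optimalCouplings μ.1 ν.1) : transportCost γ = ENNReal.ofReal (W2 μ ν ^ 2) := by
  have h1 : ⨅ γ ∈ couplings μ.1 ν.1, transportCost γ = transportCost γ :=
    le_antisymm (iInf₂_le γ h.1) (le_iInf₂ h.2)
  rw [W2, h1, Real.sq_sqrt ENNReal.toReal_nonneg,
    ENNReal.ofReal_toReal (transportCost_lt_top h.1).ne]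

theorem measurable_gradient (F : E p → ℝ) : Measurable (gradient F) :=
  (InnerProductSpace.toDual ℝ (E p)).symm.continuous.measurable.comp (measurable_fderiv ℝ F)

end Coupling

/-! ### First-order expansion of interaction energies -/

section Expansion

variable {p : ℕ}

/-- The functional `ν ↦ ∫ F dν` has the gradient `∇F`, for `F` differentiable almost everywhere. -/
theorem exists_potential_expansion {F : E p → ℝ} (hF : IsQuadLipschitz F) (μ : P2 p)
    (hd : ∀ᵐ x ∂μ.1, DifferentiableAt ℝ F x) {ε : ℝ} (hε : 0 < ε) :
    ∃ δ : ℝ, 0 < δ ∧ ∀ ν : P2 p, W2 μ ν < δ → ∀ γ ∈ optimalCouplings μ.1 ν.1,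
      |(∫ x, F x ∂ν.1) - (∫ x, F x ∂μ.1) - ∫ z, inner ℝ (gradient F z.1) (z.2 - z.1) ∂γ|
        ≤ ε * W2 μ ν := by
  obtain ⟨δ, hδ, h⟩ := exists_abs_integral_taylorRemainder_le hF μ.2.integrable_norm_sq hd hε
  refine ⟨δ, hδ, fun ν hν γ hγ => ?_⟩
  have hcost := transportCost_eq_of_mem_optimalCouplings hγ
  have hFμ := hF.integrable μ.2.integrable_norm_sq
  have hFν := hF.integrable ν.2.integrable_norm_sq
  obtain ⟨hRint, hR⟩ := h γ Prod.fst (fun z => z.2 - z.1) (W2 μ ν) measurable_fst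
    (measurable_snd.sub measurable_fst) hγ.1.1 (W2_nonneg μ ν) hν (by
      rw [← hcost, transportCost]
      exact le_of_eq (lintegral_congr fun z => by rw [enorm_sub_rev]))
  have h1 : Integrable (fun z : E p × E p => F z.1) γ := by
    rw [← hγ.1.1] at hFμ
    exact hFμ.comp_measurable measurable_fst
  have h2 : Integrable (fun z : E p × E p => F z.2) γ := by
    rw [← hγ.1.2] at hFν
    exact hFν.comp_measurable measurable_snd
  have e1 : ∫ x, F x ∂μ.1 = ∫ z, F z.1 ∂γ := by
    rw [← hγ.1.1]
    exact integral_map measurable_fst.aemeasurable hF.continuous.measurable.aestronglyMeasurable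
  have e2 : ∫ x, F x ∂ν.1 = ∫ z, F z.2 ∂γ := by
    rw [← hγ.1.2]
    exact integral_map measurable_snd.aemeasurable hF.continuous.measurable.aestronglyMeasurable
  have e3 : ∫ z, inner ℝ (gradient F z.1) (z.2 - z.1) ∂γ =
      ∫ z, (F z.2 - F z.1 - taylorRemainder F z.1 (z.2 - z.1)) ∂γ := by
    refine integral_congr_ae (.of_forall fun z => ?_)
    simp only [taylorRemainder, inner_gradient_left, add_sub_cancel]
    ring
  have h21 : Integrable (fun z : E p × E p => F z.2 - F z.1) γ := h2.sub h1
  rw [e3, integral_sub h21 hRint, integral_sub h2 h1, e1, e2, sub_sub_cancel]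
  exact hR

/-- The second-order increment of a two-body energy is `o(W₂)`: in
`φ(x', y') - φ(x', y) - φ(x, y') + φ(x, y)` the first-order terms cancel. -/
theorem exists_interaction_expansion {φ : E p × E p → ℝ} (hφ : IsQuadLipschitz φ) (μ : P2 p)
    (hd : ∀ᵐ z ∂μ.1.prod μ.1, DifferentiableAt ℝ φ z) {ε : ℝ} (hε : 0 < ε) :
    ∃ δ : ℝ, 0 < δ ∧ ∀ ν : P2 p, W2 μ ν < δ → ∀ γ ∈ optimalCouplings μ.1 ν.1,
      |(∫ z, φ z ∂ν.1.prod ν.1) - (∫ z, φ z ∂ν.1.prod μ.1) - (∫ z, φ z ∂μ.1.prod ν.1)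
        + ∫ z, φ z ∂μ.1.prod μ.1| ≤ ε * W2 μ ν := by
  obtain ⟨δ, hδ, h⟩ := exists_abs_integral_taylorRemainder_le hφ
    (integrable_norm_sq_prod μ.2.integrable_norm_sq μ.2.integrable_norm_sq) hd
    (by positivity : 0 < ε / 6)
  refine ⟨δ / 2, by positivity, fun ν hν γ hγ => ?_⟩
  have hcost := transportCost_eq_of_mem_optimalCouplings hγ
  have := isProbabilityMeasure_of_mem_couplings hγ.1
  have hW := W2_nonneg μ ν
  set W := W2 μ ν
  -- laws of the four pairs of points under two independent copies of the coupling
  have hlaw : ∀ {a b : E p × E p → E p} {α β : P2 p}, Measurable a → Measurable b →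
      γ.map a = α.1 → γ.map b = β.1 →
      (γ.prod γ).map (fun t => (a t.1, b t.2)) = α.1.prod β.1 := fun {a b α β} ha hb hα hβ => by
    rw [← hα, ← hβ, Measure.map_prod_map γ γ ha hb]
    rfl
  have hφi : ∀ α β : P2 p, Integrable φ (α.1.prod β.1) := fun α β =>
    hφ.integrable (integrable_norm_sq_prod α.2.integrable_norm_sq β.2.integrable_norm_sq)
  have hint : ∀ {a b : E p × E p → E p} {α β : P2 p}, Measurable a → Measurable b →
      γ.map a = α.1 → γ.map b = β.1 →
      Integrable (fun t : (E p × E p) × (E p × E p) => φ (a t.1, b t.2)) (γ.prod γ) ∧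
      ∫ z, φ z ∂α.1.prod β.1 = ∫ t, φ (a t.1, b t.2) ∂γ.prod γ := fun {a b α β} ha hb hα hβ => by
    have hm : Measurable fun t : (E p × E p) × (E p × E p) => (a t.1, b t.2) :=
      (ha.comp measurable_fst).prodMk (hb.comp measurable_snd)
    have h0 := hφi α β
    rw [← hlaw ha hb hα hβ] at h0 ⊢
    exact ⟨h0.comp_measurable hm,
      integral_map hm.aemeasurable hφ.continuous.measurable.aestronglyMeasurable⟩
  obtain ⟨i22, e22⟩ := hint measurable_snd measurable_snd hγ.1.2 hγ.1.2
  obtain ⟨i21, e21⟩ := hint measurable_snd measurable_fst hγ.1.2 hγ.1.1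
  obtain ⟨i12, e12⟩ := hint measurable_fst measurable_snd hγ.1.1 hγ.1.2
  obtain ⟨i11, e11⟩ := hint measurable_fst measurable_fst hγ.1.1 hγ.1.1
  have hm1 : Measurable fun t : (E p × E p) × (E p × E p) => t.1.2 - t.1.1 := by fun_prop
  have hm2 : Measurable fun t : (E p × E p) × (E p × E p) => t.2.2 - t.2.1 := by fun_prop
  have c1 : ∫⁻ t, ‖t.1.2 - t.1.1‖ₑ ^ 2 ∂γ.prod γ = ENNReal.ofReal (W ^ 2) := by
    rw [← hcost, transportCost, lintegral_prod _ (by fun_prop)]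
    simp [enorm_sub_rev]
  have c2 : ∫⁻ t, ‖t.2.2 - t.2.1‖ₑ ^ 2 ∂γ.prod γ = ENNReal.ofReal (W ^ 2) := by
    rw [← hcost, transportCost, lintegral_prod _ (by fun_prop)]
    simp [enorm_sub_rev]
  have hc : ∀ D : (E p × E p) × (E p × E p) → E p × E p,
      (∀ t, ‖D t‖ₑ ^ 2 ≤ ‖t.1.2 - t.1.1‖ₑ ^ 2 + ‖t.2.2 - t.2.1‖ₑ ^ 2) →
      ∫⁻ t, ‖D t‖ₑ ^ 2 ∂γ.prod γ ≤ ENNReal.ofReal ((2 * W) ^ 2) := fun D hD => by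
    refine (lintegral_mono hD).trans ?_
    rw [lintegral_add_left (by fun_prop), c1, c2, ← ENNReal.ofReal_add (by positivity)
      (by positivity)]
    exact ENNReal.ofReal_le_ofReal (by nlinarith [sq_nonneg W])
  have hZ : Measurable fun t : (E p × E p) × (E p × E p) => (t.1.1, t.2.1) := by fun_prop
  have hn : ∀ u v : E p, ‖(u, v)‖ₑ ^ 2 ≤ ‖u‖ₑ ^ 2 + ‖v‖ₑ ^ 2 := fun u v => by
    rcases max_choice ‖u‖ ‖v‖ with hm | hm <;>
      rw [← ofReal_norm (u, v), Prod.norm_mk, hm, ofReal_norm]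
    exacts [le_self_add, le_add_self]
  obtain ⟨j1, r1⟩ := h (γ.prod γ) (fun t => (t.1.1, t.2.1))
    (fun t => (t.1.2 - t.1.1, t.2.2 - t.2.1)) (2 * W) hZ (hm1.prodMk hm2)
    (hlaw measurable_fst measurable_fst hγ.1.1 hγ.1.1) (by positivity) (by linarith)
    (hc _ fun t => hn _ _)
  obtain ⟨j2, r2⟩ := h (γ.prod γ) (fun t => (t.1.1, t.2.1))
    (fun t => (t.1.2 - t.1.1, 0)) (2 * W) hZ (hm1.prodMk measurable_const)
    (hlaw measurable_fst measurable_fst hγ.1.1 hγ.1.1) (by positivity) (by linarith)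
    (hc _ fun t => (hn _ _).trans (by simp))
  obtain ⟨j3, r3⟩ := h (γ.prod γ) (fun t => (t.1.1, t.2.1))
    (fun t => (0, t.2.2 - t.2.1)) (2 * W) hZ (measurable_const.prodMk hm2)
    (hlaw measurable_fst measurable_fst hγ.1.1 hγ.1.1) (by positivity) (by linarith)
    (hc _ fun t => (hn _ _).trans (by simp))
  have key : (∫ z, φ z ∂ν.1.prod ν.1) - (∫ z, φ z ∂ν.1.prod μ.1) - (∫ z, φ z ∂μ.1.prod ν.1)
      + ∫ z, φ z ∂μ.1.prod μ.1 =
      (∫ t, taylorRemainder φ (t.1.1, t.2.1) (t.1.2 - t.1.1, t.2.2 - t.2.1) ∂γ.prod γ)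
      - (∫ t, taylorRemainder φ (t.1.1, t.2.1) (t.1.2 - t.1.1, 0) ∂γ.prod γ)
      - ∫ t, taylorRemainder φ (t.1.1, t.2.1) (0, t.2.2 - t.2.1) ∂γ.prod γ := by
    have i3 : Integrable (fun t : (E p × E p) × (E p × E p) =>
        φ (t.1.2, t.2.2) - φ (t.1.2, t.2.1) - φ (t.1.1, t.2.2)) (γ.prod γ) := (i22.sub i21).sub i12
    have j12 : Integrable (fun t : (E p × E p) × (E p × E p) =>
        taylorRemainder φ (t.1.1, t.2.1) (t.1.2 - t.1.1, t.2.2 - t.2.1) -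
        taylorRemainder φ (t.1.1, t.2.1) (t.1.2 - t.1.1, 0)) (γ.prod γ) := j1.sub j2
    rw [e22, e21, e12, e11, ← integral_sub i22 i21, ← integral_sub (by exact i22.sub i21) i12,
      ← integral_add i3 i11, ← integral_sub j1 j2, ← integral_sub j12 j3]
    refine integral_congr_ae (.of_forall fun t => ?_)
    have hlin : fderiv ℝ φ (t.1.1, t.2.1) (t.1.2 - t.1.1, t.2.2 - t.2.1) =
        fderiv ℝ φ (t.1.1, t.2.1) (t.1.2 - t.1.1, 0)
        + fderiv ℝ φ (t.1.1, t.2.1) (0, t.2.2 - t.2.1) := by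
      rw [← map_add]
      simp
    simp only [taylorRemainder, Prod.mk_add_mk, add_sub_cancel, add_zero, hlin]
    ring
  rw [key]
  rw [abs_le] at r1 r2 r3 ⊢
  constructor <;> linarith [r1.1, r1.2, r2.1, r2.2, r3.1, r3.2]

/-- The energy `½ ∬ φ d(ν ⊗ ν)` of a symmetric `φ` has the gradient `∇ ∫ φ(·, y) dμ(y)` at `μ`. -/
theorem exists_energy_expansion {φ : E p × E p → ℝ} (hφ : IsQuadLipschitz φ)
    (hsymm : ∀ z, φ z.swap = φ z) (μ : P2 p)
    (hd : ∀ᵐ z ∂μ.1.prod μ.1, DifferentiableAt ℝ φ z)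
    (hdF : ∀ᵐ x ∂μ.1, DifferentiableAt ℝ (fun x => ∫ y, φ (x, y) ∂μ.1) x) {ε : ℝ} (hε : 0 < ε) :
    ∃ δ : ℝ, 0 < δ ∧ ∀ ν : P2 p, W2 μ ν < δ → ∀ γ ∈ optimalCouplings μ.1 ν.1,
      |1 / 2 * (∫ z, φ z ∂ν.1.prod ν.1) - 1 / 2 * (∫ z, φ z ∂μ.1.prod μ.1)
        - ∫ z, inner ℝ (gradient (fun x => ∫ y, φ (x, y) ∂μ.1) z.1) (z.2 - z.1) ∂γ|
        ≤ ε * W2 μ ν := by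
  obtain ⟨δ₁, hδ₁, h₁⟩ := exists_potential_expansion
    (hφ.integral_right μ.2.integrable_norm_sq) μ hdF (by positivity : 0 < ε / 2)
  obtain ⟨δ₂, hδ₂, h₂⟩ := exists_interaction_expansion hφ μ hd hε
  refine ⟨min δ₁ δ₂, lt_min hδ₁ hδ₂, fun ν hν γ hγ => ?_⟩
  have a1 := h₁ ν (hν.trans_le (min_le_left _ _)) γ hγ
  have a2 := h₂ ν (hν.trans_le (min_le_right _ _)) γ hγ
  have hφi : ∀ α β : P2 p, Integrable φ (α.1.prod β.1) := fun α β =>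
    hφ.integrable (integrable_norm_sq_prod α.2.integrable_norm_sq β.2.integrable_norm_sq)
  have e1 : ∫ z, φ z ∂μ.1.prod ν.1 = ∫ z, φ z ∂ν.1.prod μ.1 := by
    rw [← integral_prod_swap]
    exact integral_congr_ae (.of_forall hsymm)
  rw [← integral_prod _ (hφi ν μ), ← integral_prod _ (hφi μ μ)] at a1
  rw [e1] at a2
  rw [abs_le] at a1 a2 ⊢
  constructor <;> linarith [a1.1, a1.2, a2.1, a2.2]

end Expansion

/-! ### Mollification at a point of differentiability -/

section Mollify

variable {p : ℕ}

/-- The mollification `x ↦ ∫ F (x - y / r) η y dy` of `F` at scale `1 / r`. Writing it as the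
convolution of a rescaled `F` with the fixed profile `η` keeps the profile out of the limit. -/
noncomputable def mollify (η F : E p → ℝ) (r : ℝ) (x : E p) : ℝ :=
  convolution (fun u => F (r⁻¹ • u)) η (ContinuousLinearMap.lsmul ℝ ℝ) volume (r • x)

variable {η F : E p → ℝ}


theorem contDiff_mollify (hη : ContDiff ℝ ∞ η) (hc : HasCompactSupport η)
    (hF : Continuous F) (r : ℝ) : ContDiff ℝ ∞ (mollify η F r) := by
  have h : ContDiff ℝ ∞ (convolution (fun u => F (r⁻¹ • u)) η (ContinuousLinearMap.lsmul ℝ ℝ)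
      volume) :=
    hc.contDiff_convolution_right _ (by fun_prop : Continuous fun u => F (r⁻¹ • u)).locallyIntegrable
      hη
  exact h.comp (contDiff_const_smul r)

theorem mollify_eq {r : ℝ} (hr : r ≠ 0) (x : E p) :
    mollify η F r x = ∫ y, F (x - r⁻¹ • y) * η y := by
  rw [mollify, convolution_eq_swap]
  simp [smul_sub, inv_smul_smul₀ hr]

theorem fderiv_mollify (hη : ContDiff ℝ ∞ η) (hc : HasCompactSupport η)
    (hF : Continuous F) {r : ℝ} (hr : r ≠ 0) (x : E p) :
    fderiv ℝ (mollify η F r) x = r • ∫ y, F (x - r⁻¹ • y) • fderiv ℝ η y := by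
  have h := hc.hasFDerivAt_convolution_right (ContinuousLinearMap.lsmul ℝ ℝ)
    (by fun_prop : Continuous fun u => F (r⁻¹ • u)).locallyIntegrable (μ := volume)
    (hη.of_le (by norm_cast)) (r • x)
  have h2 : HasFDerivAt (fun x : E p => r • x) (r • ContinuousLinearMap.id ℝ (E p)) x :=
    (hasFDerivAt_id x).const_smul r
  have h3 := (h.comp x h2).fderiv
  rw [convolution_eq_swap] at h3
  refine Eq.trans h3 ?_
  rw [ContinuousLinearMap.comp_smul, ContinuousLinearMap.comp_id]
  congr 1
  refine integral_congr_ae (.of_forall fun y => ?_)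
  ext v
  simp [ContinuousLinearMap.precompR_apply, smul_sub, inv_smul_smul₀ hr]

theorem integrable_smul_fderiv (hη : ContDiff ℝ ∞ η) (hc : HasCompactSupport η)
    {c : E p → ℝ} (hcont : Continuous c) :
    Integrable (fun y => c y • fderiv ℝ η y) := by
  have h1 : Continuous (fderiv ℝ η) := hη.continuous_fderiv (by simp)
  exact (hcont.smul h1).integrable_of_hasCompactSupport (hc.fderiv ℝ).smul_left

theorem integral_fderiv_eq_zero (hη : ContDiff ℝ ∞ η) (hc : HasCompactSupport η) :
    ∫ y, fderiv ℝ η y = 0 := by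
  have h0 := integrable_smul_fderiv hη hc (continuous_const (y := (1 : ℝ)))
  simp only [one_smul] at h0
  ext v
  rw [ContinuousLinearMap.integral_apply h0]
  have h := integral_mul_fderiv_eq_neg_fderiv_mul_of_integrable (μ := volume)
    (f := fun _ : E p => (1 : ℝ)) (g := η) (v := v) (by simp)
    (by simpa using h0.apply_continuousLinearMap v)
    (by simpa using hη.continuous.integrable_of_hasCompactSupport hc)
    (fun _ _ => differentiableAt_const _) (fun x _ => hη.differentiable (by simp) x)
  simpa using h

/-- Integration by parts; so the derivative of a mollified linear function is that function. -/
theorem integral_smul_fderiv_eq_neg (hη : ContDiff ℝ ∞ η) (hc : HasCompactSupport η)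
    (h1 : ∫ y, η y = 1) (L : E p →L[ℝ] ℝ) :
    ∫ y, L y • fderiv ℝ η y = -L := by
  have h0 := integrable_smul_fderiv hη hc L.continuous
  ext v
  rw [ContinuousLinearMap.integral_apply h0]
  have h := integral_mul_fderiv_eq_neg_fderiv_mul_of_integrable (μ := volume)
    (f := L) (g := η) (v := v)
    (by simpa using (hη.continuous.integrable_of_hasCompactSupport hc).const_mul (L v))
    (by simpa using h0.apply_continuousLinearMap v)
    ((L.continuous.mul hη.continuous).integrable_of_hasCompactSupport hc.mul_left)
    (fun _ _ => L.differentiableAt) (fun x _ => hη.differentiable (by simp) x)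
  simpa [integral_const_mul, h1] using h

/-- As `∫ ∇η = 0`, the derivative of a mollification is an average of difference quotients of `F`. -/
theorem fderiv_mollify_eq (hη : ContDiff ℝ ∞ η) (hc : HasCompactSupport η)
    (hF : Continuous F) {r : ℝ} (hr : r ≠ 0) (x : E p) :
    fderiv ℝ (mollify η F r) x = ∫ y, (r * (F (x - r⁻¹ • y) - F x)) • fderiv ℝ η y := by
  have i1 := integrable_smul_fderiv hη hc (by fun_prop : Continuous fun y => F (x - r⁻¹ • y))
  have i2 := integrable_smul_fderiv hη hc (continuous_const (y := F x))
  have h : ∫ y, F x • fderiv ℝ η y = 0 := by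
    rw [integral_smul, integral_fderiv_eq_zero hη hc, smul_zero]
  rw [fderiv_mollify hη hc hF hr, ← sub_zero (∫ y, F (x - r⁻¹ • y) • fderiv ℝ η y), ← h,
    ← integral_sub i1 i2, ← integral_smul]
  simp only [← sub_smul, smul_smul]

theorem norm_smul_fderiv_le (hs : tsupport η ⊆ Metric.closedBall 0 1) {c B : ℝ} (y : E p)
    (h : ‖y‖ ≤ 1 → |c| ≤ B) : ‖c • fderiv ℝ η y‖ ≤ B * ‖fderiv ℝ η y‖ := by
  by_cases hy : y ∈ tsupport η
  · rw [norm_smul]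
    exact mul_le_mul_of_nonneg_right (h (by simpa using hs hy)) (norm_nonneg _)
  · have : fderiv ℝ η y = 0 := by
      by_contra hne
      exact hy (support_fderiv_subset ℝ hne)
    simp [this]

theorem abs_scaled_increment_le {C : ℝ} (hC : 0 ≤ C)
    (h : ∀ z z', |F z' - F z| ≤ C * (1 + ‖z‖ + ‖z'‖) * ‖z' - z‖) {r : ℝ} (hr : 1 ≤ r) (x : E p)
    {y : E p} (hy : ‖y‖ ≤ 1) : |r * (F (x - r⁻¹ • y) - F x)| ≤ C * (2 + 2 * ‖x‖) := by
  have hr0 : 0 < r := by linarith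
  have hsm : ‖(x - r⁻¹ • y) - x‖ = r⁻¹ * ‖y‖ := by
    rw [sub_sub_cancel_left, norm_neg, norm_smul, Real.norm_of_nonneg (by positivity)]
  have hle : r⁻¹ * ‖y‖ ≤ 1 := mul_le_one₀ (inv_le_one_of_one_le₀ hr) (norm_nonneg _) hy
  have h1 := IsQuadLipschitz.abs_le_of_norm_sub_le_one hC h (z := x) (z' := x - r⁻¹ • y)
    (by rw [hsm]; exact hle)
  rw [hsm] at h1
  rw [abs_mul, abs_of_pos hr0]
  calc r * |F (x - r⁻¹ • y) - F x| ≤ r * (C * (2 + 2 * ‖x‖) * (r⁻¹ * ‖y‖)) := by gcongr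
    _ = C * (2 + 2 * ‖x‖) * ‖y‖ := by field_simp
    _ ≤ C * (2 + 2 * ‖x‖) * 1 := by gcongr
    _ = _ := mul_one _

theorem norm_fderiv_mollify_le (hη : ContDiff ℝ ∞ η) (hc : HasCompactSupport η)
    (hs : tsupport η ⊆ Metric.closedBall 0 1) (hF : IsQuadLipschitz F) :
    ∃ B : ℝ, 0 ≤ B ∧ ∀ r : ℝ, 1 ≤ r → ∀ x, ‖fderiv ℝ (mollify η F r) x‖ ≤ B * (1 + ‖x‖) := by
  have hcont := hF.continuous
  obtain ⟨C, hC, h⟩ := hF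
  have i := integrable_smul_fderiv hη hc (continuous_const (y := (1 : ℝ)))
  simp only [one_smul] at i
  have hI : 0 ≤ ∫ y, ‖fderiv ℝ η y‖ := integral_nonneg fun _ => norm_nonneg _
  refine ⟨2 * C * ∫ y, ‖fderiv ℝ η y‖, by positivity, fun r hr x => ?_⟩
  have hr0 : 0 < r := by linarith
  rw [fderiv_mollify_eq hη hc hcont hr0.ne']
  refine (norm_integral_le_of_norm_le (i.norm.const_mul (C * (2 + 2 * ‖x‖)))
    (.of_forall fun y => norm_smul_fderiv_le hs y fun hy => ?_)).trans_eq ?_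
  · exact abs_scaled_increment_le hC h hr x hy
  · rw [integral_const_mul]
    ring

/-- The derivatives of the mollifications converge at every point of differentiability; no
continuity of the derivative is needed. -/
theorem tendsto_fderiv_mollify (hη : ContDiff ℝ ∞ η) (hc : HasCompactSupport η)
    (h1 : ∫ y, η y = 1) (hs : tsupport η ⊆ Metric.closedBall 0 1)
    (hF : IsQuadLipschitz F) {x : E p} (hx : DifferentiableAt ℝ F x) :
    Filter.Tendsto (fun n : ℕ => fderiv ℝ (mollify η F (n + 1)) x) Filter.atTop
      (nhds (fderiv ℝ F x)) := by
  have hcont := hF.continuous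
  obtain ⟨C, hC, h⟩ := hF
  have i := integrable_smul_fderiv hη hc (continuous_const (y := (1 : ℝ)))
  simp only [one_smul] at i
  have hlim : ∫ y, (-fderiv ℝ F x y) • fderiv ℝ η y = fderiv ℝ F x := by
    have := integral_smul_fderiv_eq_neg hη hc h1 (-fderiv ℝ F x)
    simpa using this
  have hn : ∀ n : ℕ, ((n : ℝ) + 1) ≠ 0 := fun n => by positivity
  simp only [fun n : ℕ => fderiv_mollify_eq hη hc hcont (hn n) x]
  rw [← hlim]
  refine tendsto_integral_of_dominated_convergence
    (fun y => C * (2 + 2 * ‖x‖) * ‖fderiv ℝ η y‖) (fun n => ?_) (i.norm.const_mul _)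
    (fun n => .of_forall fun y => norm_smul_fderiv_le hs y fun hy => ?_) (.of_forall fun y => ?_)
  · exact (integrable_smul_fderiv hη hc (by fun_prop)).aestronglyMeasurable
  · have hr : (1 : ℝ) ≤ n + 1 := by linarith [(Nat.cast_nonneg n : (0 : ℝ) ≤ n)]
    exact abs_scaled_increment_le hC h hr x hy
  · refine Filter.Tendsto.smul_const ?_ _
    have hl := (hx.hasFDerivAt.lim_real (-y)).comp
      (Filter.tendsto_atTop_add_const_right _ (1 : ℝ) tendsto_natCast_atTop_atTop)
    simpa [sub_eq_add_neg, Function.comp_def] using hl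

end Mollify

/-! ### Gradients of functions differentiable almost everywhere are tangent -/

section Tangent

variable {p : ℕ}

/-- Approximation of `F` by smooth compactly supported functions whose derivatives converge
wherever `F` is differentiable and grow at most linearly, uniformly along the sequence. -/
theorem exists_smooth_approximation {F : E p → ℝ} (hF : IsQuadLipschitz F) :
    ∃ (ψ : ℕ → E p → ℝ) (B : ℝ), 0 ≤ B ∧ (∀ n, ContDiff ℝ ∞ (ψ n) ∧ HasCompactSupport (ψ n) ∧
      ∀ x, ‖fderiv ℝ (ψ n) x‖ ≤ B * (1 + ‖x‖)) ∧
      ∀ x, DifferentiableAt ℝ F x →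
        Filter.Tendsto (fun n => fderiv ℝ (ψ n) x) Filter.atTop (nhds (fderiv ℝ F x)) := by
  let f : ContDiffBump (0 : E p) := ⟨1 / 2, 1, by norm_num, by norm_num⟩
  let χ : ContDiffBump (0 : E p) := ⟨1, 2, by norm_num, by norm_num⟩
  set η : E p → ℝ := f.normed volume with hηdef
  have hη : ContDiff ℝ ∞ η := f.contDiff_normed
  have hc : HasCompactSupport η := f.hasCompactSupport_normed
  have h1 : ∫ y, η y = 1 := f.integral_normed
  have hη0 : ∀ y, 0 ≤ η y := fun y => f.nonneg_normed y
  have hs : tsupport η ⊆ Metric.closedBall 0 1 := f.tsupport_normed_eq.subset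
  obtain ⟨B, hB, hBb⟩ := norm_fderiv_mollify_le hη hc hs hF
  obtain ⟨A, hA, hAb⟩ := hF.exists_abs_le
  -- size of the mollifications
  have hval : ∀ r : ℝ, 1 ≤ r → ∀ x, |mollify η F r x| ≤ A * (3 + 2 * ‖x‖ ^ 2) := by
    intro r hr x
    have hr0 : 0 < r := by linarith
    rw [mollify_eq hr0.ne']
    have hb : Integrable (fun y => A * (3 + 2 * ‖x‖ ^ 2) * η y) :=
      (hη.continuous.integrable_of_hasCompactSupport hc).const_mul _
    refine (norm_integral_le_of_norm_le (f := fun y => F (x - r⁻¹ • y) * η y) hb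
      (.of_forall fun y => ?_)).trans_eq ?_
    · by_cases hy : y ∈ tsupport η
      · have hy1 : ‖y‖ ≤ 1 := by simpa using hs hy
        have h2 : ‖x - r⁻¹ • y‖ ≤ ‖x‖ + 1 := by
          refine (norm_sub_le _ _).trans ?_
          rw [norm_smul, Real.norm_of_nonneg (by positivity)]
          have := mul_le_one₀ (inv_le_one_of_one_le₀ hr) (norm_nonneg y) hy1
          linarith
        rw [norm_mul, Real.norm_of_nonneg (hη0 y)]
        refine mul_le_mul_of_nonneg_right ((hAb _).trans (mul_le_mul_of_nonneg_left ?_ hA)) (hη0 y)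
        nlinarith [norm_nonneg (x - r⁻¹ • y), norm_nonneg x, sq_nonneg (‖x‖ - 1)]
      · have : η y = 0 := image_eq_zero_of_notMem_tsupport hy
        simp [this]
    · rw [integral_const_mul, h1, mul_one]
  -- the cutoff
  have hχ : ContDiff ℝ ∞ χ := χ.contDiff
  obtain ⟨D, hD⟩ := (χ.hasCompactSupport.fderiv ℝ).exists_bound_of_continuous
    (hχ.continuous_fderiv (by simp))
  have hD0 : 0 ≤ D := (norm_nonneg _).trans (hD 0)
  have hN : ∀ n : ℕ, (0 : ℝ) < n + 1 := fun n => by positivity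
  have hN1 : ∀ n : ℕ, (1 : ℝ) ≤ n + 1 := fun n => by
    linarith [(Nat.cast_nonneg n : (0 : ℝ) ≤ n)]
  let c : ℕ → E p → ℝ := fun n x => χ (((n : ℝ) + 1)⁻¹ • x)
  have hcd : ∀ n, ContDiff ℝ ∞ (c n) := fun n => hχ.comp (contDiff_const_smul _)
  have hcf : ∀ n x, fderiv ℝ (c n) x
      = ((n : ℝ) + 1)⁻¹ • fderiv ℝ χ (((n : ℝ) + 1)⁻¹ • x) := fun n x => by
    have h2 : HasFDerivAt (fun x : E p => ((n : ℝ) + 1)⁻¹ • x)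
      (((n : ℝ) + 1)⁻¹ • ContinuousLinearMap.id ℝ (E p)) x :=
      (hasFDerivAt_id x).const_smul (((n : ℝ) + 1)⁻¹)
    have h3 := ((hχ.differentiable (by simp) (((n : ℝ) + 1)⁻¹ • x)).hasFDerivAt.comp x h2).fderiv
    rw [ContinuousLinearMap.comp_smul, ContinuousLinearMap.comp_id] at h3
    exact h3
  have hmd : ∀ n : ℕ, ContDiff ℝ ∞ (mollify η F (n + 1)) := fun n =>
    contDiff_mollify hη hc hF.continuous _
  have hfd : ∀ (n : ℕ) x, fderiv ℝ (fun x => c n x * mollify η F (n + 1) x) x =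
      c n x • fderiv ℝ (mollify η F (n + 1)) x + mollify η F (n + 1) x • fderiv ℝ (c n) x :=
    fun n x => fderiv_fun_mul ((hcd n).differentiable (by simp) x)
      ((hmd n).differentiable (by simp) x)
  refine ⟨fun n x => c n x * mollify η F (n + 1) x, B + 4 * A * D, by positivity,
    fun n => ⟨(hcd n).mul (hmd n), ?_, fun x => ?_⟩, fun x hx => ?_⟩
  · refine HasCompactSupport.mul_right ?_
    exact χ.hasCompactSupport.comp_smul (inv_ne_zero (hN n).ne')
  · rw [hfd]
    have t1 : ‖c n x • fderiv ℝ (mollify η F (n + 1)) x‖ ≤ B * (1 + ‖x‖) := by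
      rw [norm_smul, Real.norm_of_nonneg χ.nonneg]
      exact (mul_le_of_le_one_left (norm_nonneg _) χ.le_one).trans (hBb _ (hN1 n) x)
    have t2 : ‖mollify η F (n + 1) x • fderiv ℝ (c n) x‖ ≤ 4 * A * D * (1 + ‖x‖) := by
      rw [hcf, norm_smul, norm_smul, Real.norm_of_nonneg (inv_nonneg.2 (hN n).le)]
      by_cases hx2 : ‖x‖ ≤ 2 * (n + 1)
      · -- the quadratic growth of `F` is absorbed by the slope `1 / n` of the cutoff
        have h3 : (3 + 2 * ‖x‖ ^ 2) * ((n : ℝ) + 1)⁻¹ ≤ 4 * (1 + ‖x‖) := by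
          rw [← div_eq_mul_inv, div_le_iff₀ (hN n)]
          nlinarith [mul_le_mul_of_nonneg_left hx2 (norm_nonneg x), norm_nonneg x,
            mul_nonneg (norm_nonneg x) (hN n).le, hN1 n]
        calc ‖mollify η F (n + 1) x‖ * (((n : ℝ) + 1)⁻¹ * ‖fderiv ℝ χ (((n : ℝ) + 1)⁻¹ • x)‖)
            ≤ A * (3 + 2 * ‖x‖ ^ 2) * (((n : ℝ) + 1)⁻¹ * D) := by
              have := hN n
              gcongr
              exacts [hval _ (hN1 n) x, hD _]
          _ = A * D * ((3 + 2 * ‖x‖ ^ 2) * ((n : ℝ) + 1)⁻¹) := by ring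
          _ ≤ A * D * (4 * (1 + ‖x‖)) := by gcongr
          _ = _ := by ring
      · have h4 : fderiv ℝ χ (((n : ℝ) + 1)⁻¹ • x) = 0 := by
          by_contra hne
          have h5 := support_fderiv_subset ℝ hne
          rw [χ.tsupport_eq, mem_closedBall_zero_iff, norm_smul,
            Real.norm_of_nonneg (inv_nonneg.2 (hN n).le), inv_mul_le_iff₀ (hN n)] at h5
          exact hx2 (h5.trans_eq (mul_comm _ _))
        rw [h4]
        simp only [norm_zero, mul_zero]
        positivity
    calc _ ≤ _ := norm_add_le _ _
      _ ≤ B * (1 + ‖x‖) + 4 * A * D * (1 + ‖x‖) := add_le_add t1 t2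
      _ = _ := by ring
  · refine (tendsto_fderiv_mollify hη hc h1 hs hF hx).congr' ?_
    obtain ⟨N, hNx⟩ := exists_nat_gt ‖x‖
    filter_upwards [Filter.eventually_ge_atTop N] with n hn
    have hnx : ‖x‖ < n + 1 := by
      have : (N : ℝ) ≤ n := by exact_mod_cast hn
      linarith
    refine Filter.EventuallyEq.fderiv_eq ?_
    have hopen : ∀ᶠ y in nhds x, ‖y‖ < n + 1 :=
      (isOpen_lt continuous_norm continuous_const).mem_nhds hnx
    filter_upwards [hopen] with y hy
    have : c n y = 1 := by
      refine χ.one_of_mem_closedBall ?_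
      rw [mem_closedBall_zero_iff, norm_smul, Real.norm_of_nonneg (inv_nonneg.2 (hN n).le),
        inv_mul_le_iff₀ (hN n)]
      exact hy.le.trans_eq (mul_one _).symm
    rw [this, one_mul]

theorem memLp_two_of_norm_le {μ : P2 p} {g : E p → E p} (hg : Measurable g) {B : ℝ}
    (h : ∀ x, ‖g x‖ ≤ B * (1 + ‖x‖)) : MemLp g 2 μ.1 := by
  rw [memLp_two_iff_integrable_sq_norm hg.aestronglyMeasurable]
  have hb : Integrable (fun x => B ^ 2 * (2 * (1 + ‖x‖ ^ 2))) μ.1 :=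
    (((integrable_const (1 : ℝ)).add μ.2.integrable_norm_sq).const_mul 2).const_mul (B ^ 2)
  refine hb.mono' (by fun_prop) (.of_forall fun x => ?_)
  rw [Real.norm_of_nonneg (by positivity)]
  calc ‖g x‖ ^ 2 ≤ (B * (1 + ‖x‖)) ^ 2 := by gcongr; exact h x
    _ ≤ _ := by nlinarith [mul_nonneg (sq_nonneg B) (sq_nonneg (1 - ‖x‖))]

theorem norm_gradient (F : E p → ℝ) (x : E p) : ‖gradient F x‖ = ‖fderiv ℝ F x‖ := by
  rw [← toDual_gradient, LinearIsometryEquiv.norm_map]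

theorem IsQuadLipschitz.exists_norm_gradient_le {F : E p → ℝ} (hF : IsQuadLipschitz F) :
    ∃ B : ℝ, 0 ≤ B ∧ ∀ x, ‖gradient F x‖ ≤ B * (1 + ‖x‖) := by
  obtain ⟨C, hC, h⟩ := hF
  refine ⟨2 * C, by positivity, fun x => ?_⟩
  rw [norm_gradient]
  exact (IsQuadLipschitz.norm_fderiv_le hC h x).trans_eq (by ring)

/-- No regularity of `μ` is needed: differentiability of `F` at `μ`-almost every point suffices. -/
theorem inTangentSpace_gradient {F : E p → ℝ} (hF : IsQuadLipschitz F) (μ : P2 p)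
    (hd : ∀ᵐ x ∂μ.1, DifferentiableAt ℝ F x) : InTangentSpace μ (gradient F) := by
  obtain ⟨B, hB, hBx⟩ := hF.exists_norm_gradient_le
  refine ⟨memLp_two_of_norm_le (measurable_gradient F) hBx, fun ε hε => ?_⟩
  obtain ⟨ψ, B', hB', hψ, hlim⟩ := exists_smooth_approximation hF
  have hle : ∀ n x, ‖gradient F x - gradient (ψ n) x‖ ≤ (B + B') * (1 + ‖x‖) := fun n x => by
    refine (norm_sub_le _ _).trans ?_
    rw [norm_gradient (ψ n)]
    linarith [hBx x, (hψ n).2.2 x]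
  have hmeas : ∀ n, Measurable fun x => gradient F x - gradient (ψ n) x := fun n =>
    (measurable_gradient F).sub (measurable_gradient (ψ n))
  have hdom : ∫⁻ x, ENNReal.ofReal ((B + B') * (1 + ‖x‖)) ^ 2 ∂μ.1 ≠ ⊤ := by
    have hb : Integrable (fun x => (B + B') ^ 2 * (2 * (1 + ‖x‖ ^ 2))) μ.1 :=
      (((integrable_const (1 : ℝ)).add μ.2.integrable_norm_sq).const_mul 2).const_mul _
    refine ((lintegral_mono fun x => ?_).trans_lt hb.lintegral_lt_top).ne
    rw [← ENNReal.ofReal_pow (by positivity)]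
    refine ENNReal.ofReal_le_ofReal ?_
    nlinarith [mul_nonneg (sq_nonneg (B + B')) (sq_nonneg (1 - ‖x‖))]
  have hl : Filter.Tendsto (fun n => ∫⁻ x, ‖gradient F x - gradient (ψ n) x‖ₑ ^ 2 ∂μ.1)
      Filter.atTop (nhds (∫⁻ _, 0 ∂μ.1)) := by
    refine tendsto_lintegral_of_dominated_convergence _ (fun n => (hmeas n).enorm.pow_const 2)
      (fun n => .of_forall fun x => ?_) hdom ?_
    · simp only [← ofReal_norm (gradient F x - _)]
      exact pow_le_pow_left' (ENNReal.ofReal_le_ofReal (hle n x)) 2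
    · filter_upwards [hd] with x hx
      have h1 : Filter.Tendsto (fun n => gradient (ψ n) x) Filter.atTop (nhds (gradient F x)) :=
        ((InnerProductSpace.toDual ℝ (E p)).symm.continuous.tendsto _).comp (hlim x hx)
      have h2 := (h1.const_sub (gradient F x)).enorm
      rw [sub_self, enorm_zero] at h2
      have h3 := ((ENNReal.continuous_pow 2).tendsto 0).comp h2
      rwa [zero_pow two_ne_zero] at h3
  rw [lintegral_zero] at hl
  have hr := ((ENNReal.continuous_rpow_const (y := 1 / 2)).tendsto 0).comp hl
  rw [ENNReal.zero_rpow_of_pos (by norm_num)] at hr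
  obtain ⟨n, hn⟩ := (hr.eventually_lt_const (ENNReal.ofReal_pos.2 hε)).exists
  refine ⟨ψ n, (hψ n).1, (hψ n).2.1, ?_⟩
  rw [eLpNorm_eq_lintegral_rpow_enorm_toReal two_ne_zero ENNReal.ofNat_ne_top]
  simpa using hn

end Tangent

/-! ### Optimality of small gradient perturbations of the identity -/

section Perturbation

variable {p : ℕ}

/-- The gradient of a test function is Lipschitz, and so its Taylor remainder is quadratic. -/
theorem exists_lipschitz_gradient {ψ : E p → ℝ} (hψ : ContDiff ℝ ∞ ψ) (hc : HasCompactSupport ψ) :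
    ∃ L : NNReal, LipschitzWith L (gradient ψ) ∧ ∀ x x',
      |ψ x' - ψ x - inner ℝ (gradient ψ x) (x' - x)| ≤ L * ‖x' - x‖ ^ 2 := by
  obtain ⟨L, hL⟩ := (hψ.fderiv_right (m := 1) (by norm_cast)).lipschitzWith_of_hasCompactSupport
    (hc.fderiv ℝ) one_ne_zero
  refine ⟨L, ?_, fun x x' => ?_⟩
  · have h := (InnerProductSpace.toDual ℝ (E p)).symm.lipschitz.comp hL
    rwa [one_mul] at h
  · rw [inner_gradient_left, pow_two, ← mul_assoc]
    refine (convex_closedBall x ‖x' - x‖).norm_image_sub_le_of_norm_fderiv_le' (𝕜 := ℝ)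
      (fun z _ => hψ.differentiable (by simp) z) (fun z hz => ?_) ?_ ?_
    · exact (hL.norm_sub_le z x).trans
        (mul_le_mul_of_nonneg_left (mem_closedBall_iff_norm.1 hz) L.2)
    · simp
    · simp [dist_eq_norm]

/-- The graph of `x ↦ x + t ∇ψ(x)` is an optimal coupling for small `t`. The proof is the easy half
of Kantorovich duality, with the potential `-tψ` and its conjugate for the cost `‖x - y‖² / 2`. -/
theorem graph_mem_optimalCouplings {ψ : E p → ℝ} (hψ : ContDiff ℝ ∞ ψ) (hc : HasCompactSupport ψ)
    {L : NNReal} (hLip : LipschitzWith L (gradient ψ))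
    (hL : ∀ x x', |ψ x' - ψ x - inner ℝ (gradient ψ x) (x' - x)| ≤ L * ‖x' - x‖ ^ 2)
    {t : ℝ} (ht : 0 ≤ t) (htL : t * L ≤ 1 / 2) (μ ν : P2 p)
    (hν : ν.1 = μ.1.map (fun x => x + t • gradient ψ x)) :
    μ.1.map (fun x => (x, x + t • gradient ψ x)) ∈ optimalCouplings μ.1 ν.1 := by
  set S : E p → E p := fun x => x + t • gradient ψ x with hS
  have hSc : Continuous S := continuous_id.add (hLip.continuous.const_smul t)
  have hg : Measurable fun x => (x, S x) := (continuous_id.prodMk hSc).measurable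
  refine ⟨⟨?_, ?_⟩, fun γ' hγ' => ?_⟩
  · rw [Measure.map_map measurable_fst hg]
    exact Measure.map_id
  · rw [Measure.map_map measurable_snd hg, hν]
    rfl
  obtain ⟨M, hM⟩ := hc.exists_bound_of_continuous hψ.continuous
  have hM' : ∀ x, -M ≤ ψ x ∧ ψ x ≤ M := fun x => abs_le.1 (hM x)
  have hbdd : ∀ y : E p, BddBelow (Set.range fun x => 1 / 2 * ‖x - y‖ ^ 2 + t * ψ x) := fun y => by
    refine ⟨t * -M, ?_⟩
    rintro _ ⟨x, rfl⟩
    have := mul_le_mul_of_nonneg_left (hM' x).1 ht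
    have : 0 ≤ ‖x - y‖ ^ 2 := by positivity
    simp only
    linarith
  set w : E p → ℝ := fun y => ⨅ x, (1 / 2 * ‖x - y‖ ^ 2 + t * ψ x) with hw
  have hw_meas : Measurable w := (upperSemicontinuous_ciInf hbdd fun x =>
    (by fun_prop : Continuous fun y => 1 / 2 * ‖x - y‖ ^ 2 + t * ψ x).upperSemicontinuous).measurable
  have hw_le : ∀ x y, w y ≤ 1 / 2 * ‖x - y‖ ^ 2 + t * ψ x := fun x y => ciInf_le (hbdd y) x
  have hw_ge : ∀ y, t * -M ≤ w y := fun y => le_ciInf fun x => by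
    have := mul_le_mul_of_nonneg_left (hM' x).1 ht
    have : 0 ≤ ‖x - y‖ ^ 2 := by positivity
    linarith
  have hw_abs : ∀ y, ‖w y‖ ≤ t * M := fun y => by
    have h1 := hw_le y y
    have h2 := mul_le_mul_of_nonneg_left (hM' y).2 ht
    rw [sub_self, norm_zero] at h1
    rw [Real.norm_eq_abs, abs_le]
    constructor <;> linarith [hw_ge y]
  -- equality in the duality on the graph: `x` is a minimizer for `y = S x`
  have hw_eq : ∀ x, 1 / 2 * ‖x - S x‖ ^ 2 ≤ w (S x) - t * ψ x := fun x => by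
    rw [le_sub_iff_add_le]
    refine le_ciInf fun x' => ?_
    have h1 : ‖x' - S x‖ ^ 2 = ‖x' - x‖ ^ 2 - 2 * (t * inner ℝ (gradient ψ x) (x' - x))
        + ‖t • gradient ψ x‖ ^ 2 := by
      rw [hS, ← sub_sub, norm_sub_sq_real, inner_smul_right, real_inner_comm]
    have h2 : ‖x - S x‖ ^ 2 = ‖t • gradient ψ x‖ ^ 2 := by
      rw [hS, sub_add_cancel_left, norm_neg]
    have h3 := mul_le_mul_of_nonneg_left (abs_le.1 (hL x x')).1 ht
    have h4 := mul_le_mul_of_nonneg_right htL (sq_nonneg ‖x' - x‖)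
    rw [h1, h2]
    nlinarith
  have := isProbabilityMeasure_of_mem_couplings hγ'
  have hwν : Integrable w ν.1 := Integrable.of_bound hw_meas.aestronglyMeasurable _
    (.of_forall hw_abs)
  have hψμ : Integrable ψ μ.1 := hψ.continuous.integrable_of_hasCompactSupport hc
  have hwS : Integrable (fun x => w (S x)) μ.1 :=
    Integrable.of_bound (hw_meas.comp hSc.measurable).aestronglyMeasurable _
      (.of_forall fun x => hw_abs (S x))
  have hcost : ∀ {γ : Measure (E p × E p)}, transportCost γ =
      ∫⁻ z, ENNReal.ofReal (‖z.1 - z.2‖ ^ 2) ∂γ := fun {γ} => lintegral_congr fun z => by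
    rw [ENNReal.ofReal_pow (norm_nonneg _), ofReal_norm]
  have hint : Integrable (fun z : E p × E p => ‖z.1 - z.2‖ ^ 2) γ' := by
    refine ⟨by fun_prop, ?_⟩
    have h1 := transportCost_lt_top hγ'
    rw [hcost] at h1
    exact (hasFiniteIntegral_iff_ofReal (.of_forall fun z => by positivity)).2 h1
  have hgraph : transportCost (μ.1.map fun x => (x, S x))
      = ENNReal.ofReal (∫ x, ‖x - S x‖ ^ 2 ∂μ.1) := by
    have hb : Integrable (fun x => ‖x - S x‖ ^ 2) μ.1 := by
      refine ((hwS.sub (hψμ.const_mul t)).const_mul 2).mono' (by fun_prop) (.of_forall fun x => ?_)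
      rw [Real.norm_of_nonneg (by positivity), Pi.sub_apply]
      linarith [hw_eq x]
    rw [hcost, lintegral_map (by fun_prop) hg, ofReal_integral_eq_lintegral_ofReal hb
      (.of_forall fun x => by positivity)]
  rw [hgraph, hcost, ← ofReal_integral_eq_lintegral_ofReal hint (.of_forall fun z => by positivity)]
  refine ENNReal.ofReal_le_ofReal ?_
  have e1 : ∫ y, w y ∂ν.1 = ∫ z, w z.2 ∂γ' := by
    rw [← hγ'.2]
    exact integral_map measurable_snd.aemeasurable hw_meas.aestronglyMeasurable
  have e2 : ∫ x, ψ x ∂μ.1 = ∫ z, ψ z.1 ∂γ' := by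
    rw [← hγ'.1]
    exact integral_map measurable_fst.aemeasurable hψ.continuous.aestronglyMeasurable
  have e3 : ∫ y, w y ∂ν.1 = ∫ x, w (S x) ∂μ.1 := by
    rw [hν]
    exact integral_map hSc.measurable.aemeasurable hw_meas.aestronglyMeasurable
  have i1 : Integrable (fun z : E p × E p => w z.2) γ' := by
    rw [← hγ'.2] at hwν
    exact hwν.comp_measurable measurable_snd
  have i2 : Integrable (fun z : E p × E p => ψ z.1) γ' := by
    have h := hψμ
    rw [← hγ'.1] at h
    exact h.comp_measurable measurable_fst
  calc ∫ x, ‖x - S x‖ ^ 2 ∂μ.1 ≤ ∫ x, 2 * (w (S x) - t * ψ x) ∂μ.1 := by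
        refine integral_mono_of_nonneg (.of_forall fun x => by positivity)
          ((hwS.sub (hψμ.const_mul t)).const_mul 2) (.of_forall fun x => ?_)
        simp only
        linarith [hw_eq x]
    _ = ∫ z, 2 * (w z.2 - t * ψ z.1) ∂γ' := by
        rw [integral_const_mul, integral_const_mul, integral_sub hwS (hψμ.const_mul t),
          integral_sub i1 (i2.const_mul t), integral_const_mul, integral_const_mul, ← e3, e1, e2]
    _ ≤ ∫ z, ‖z.1 - z.2‖ ^ 2 ∂γ' := by
        refine integral_mono ((i1.sub (i2.const_mul t)).const_mul 2) hint fun z => ?_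
        simp only
        linarith [hw_le z.1 z.2]

end Perturbation

/-! ### Uniqueness of the Wasserstein gradient -/

section Uniqueness

variable {p : ℕ}

theorem integrable_inner_of_memLp_two {μ : Measure (E p)} {f g : E p → E p} (hf : MemLp f 2 μ)
    (hg : MemLp g 2 μ) : Integrable (fun x => inner ℝ (f x) (g x)) μ := by
  refine ((L2.integrable_inner (𝕜 := ℝ) (hf.toLp f) (hg.toLp g)).congr ?_)
  filter_upwards [hf.coeFn_toLp, hg.coeFn_toLp] with x h1 h2
  rw [h1, h2]

theorem abs_integral_inner_le {μ : Measure (E p)} {f g : E p → E p} (hf : MemLp f 2 μ)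
    (hg : MemLp g 2 μ) :
    |∫ x, inner ℝ (f x) (g x) ∂μ| ≤ (eLpNorm f 2 μ).toReal * (eLpNorm g 2 μ).toReal := by
  have h : ∫ x, inner ℝ (f x) (g x) ∂μ = inner ℝ (hf.toLp f) (hg.toLp g) := by
    rw [L2.inner_def]
    refine integral_congr_ae ?_
    filter_upwards [hf.coeFn_toLp, hg.coeFn_toLp] with x h1 h2
    rw [h1, h2]
  rw [h, ← Lp.norm_toLp f hf, ← Lp.norm_toLp g hg]
  exact abs_real_inner_le_norm _ _

theorem memLp_gradient {ψ : E p → ℝ} (hψ : ContDiff ℝ ∞ ψ) (hc : HasCompactSupport ψ) (μ : P2 p) :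
    MemLp (gradient ψ) 2 μ.1 := by
  obtain ⟨B, hB⟩ := (hc.fderiv ℝ).exists_bound_of_continuous (hψ.continuous_fderiv (by simp))
  have hB0 : 0 ≤ B := (norm_nonneg _).trans (hB 0)
  refine memLp_two_of_norm_le (measurable_gradient ψ) (B := B) fun x => ?_
  rw [norm_gradient]
  nlinarith [hB x, norm_nonneg x]

/-- A sub- and a super-gradient are compared along the geodesic in the direction `∇ψ`. -/
theorem integral_inner_gradient_le {G : P2 p → ℝ} {μ : P2 p} {ζ ξ : E p → E p}
    (hζ : IsSubgradient G μ ζ) (hξ : IsSupergradient G μ ξ)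
    {ψ : E p → ℝ} (hψ : ContDiff ℝ ∞ ψ) (hc : HasCompactSupport ψ) :
    ∫ x, inner ℝ (ζ x) (gradient ψ x) ∂μ.1 ≤ ∫ x, inner ℝ (ξ x) (gradient ψ x) ∂μ.1 := by
  obtain ⟨L, hLip, hL⟩ := exists_lipschitz_gradient hψ hc
  have hgc : Continuous (gradient ψ) := hLip.continuous
  set N : ℝ := Real.sqrt (∫ x, ‖gradient ψ x‖ ^ 2 ∂μ.1) with hN
  have hN0 : 0 ≤ N := Real.sqrt_nonneg _
  refine le_of_forall_pos_le_add fun ε hε => ?_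
  obtain ⟨δ₁, hδ₁, h₁⟩ := hζ.2 (ε / (2 * (N + 1))) (by positivity)
  obtain ⟨δ₂, hδ₂, h₂⟩ := hξ.2 (ε / (2 * (N + 1))) (by positivity)
  obtain ⟨t, ht, htL, ht₁, ht₂⟩ : ∃ t : ℝ, 0 < t ∧ t * L ≤ 1 / 2 ∧ t * N < δ₁ ∧ t * N < δ₂ := by
    have hcont : ∀ a b : ℝ, 0 < b → ∀ᶠ t in nhdsWithin (0 : ℝ) (Set.Ioi 0), t * a < b :=
      fun a b hb => by
        have h : Filter.Tendsto (fun t : ℝ => t * a) (nhds 0) (nhds (0 * a)) :=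
          (continuous_mul_const a).tendsto 0
        rw [zero_mul] at h
        exact (h.eventually_lt_const hb).filter_mono nhdsWithin_le_nhds
    have hpos : ∀ᶠ t in nhdsWithin (0 : ℝ) (Set.Ioi 0), 0 < t := eventually_mem_nhdsWithin
    obtain ⟨t, ht, h1, h2, h3⟩ := (hpos.and ((hcont L (1 / 2) (by norm_num)).and
      ((hcont N δ₁ hδ₁).and (hcont N δ₂ hδ₂)))).exists
    exact ⟨t, ht, h1.le, h2, h3⟩
  have hSlip : LipschitzWith (1 + ‖t‖₊ * L) fun x => x + t • gradient ψ x :=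
    LipschitzWith.id.add ((lipschitzWith_smul t).comp hLip)
  let ν : P2 p := ⟨μ.1.map fun x => x + t • gradient ψ x, μ.2.map_lipschitz hSlip⟩
  have hopt := graph_mem_optimalCouplings hψ hc hLip hL ht.le htL μ ν rfl
  set γ : Measure (E p × E p) := μ.1.map fun x => (x, x + t • gradient ψ x) with hγ
  have hgm : Measurable fun x => (x, x + t • gradient ψ x) :=
    (continuous_id.prodMk hSlip.continuous).measurable
  have hgsq : Integrable (fun x => ‖gradient ψ x‖ ^ 2) μ.1 :=
    (memLp_two_iff_integrable_sq_norm hgc.measurable.aestronglyMeasurable).1 (memLp_gradient hψ hc μ)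
  have hW : W2 μ ν = t * N := by
    have h1 := transportCost_eq_of_mem_optimalCouplings hopt
    have h2 : transportCost γ = ENNReal.ofReal ((t * N) ^ 2) := by
      have h3 : ∀ x, ‖x - (x + t • gradient ψ x)‖ₑ ^ 2
          = ENNReal.ofReal (t ^ 2 * ‖gradient ψ x‖ ^ 2) := fun x => by
        rw [sub_add_cancel_left, enorm_neg, ← ofReal_norm, ← ENNReal.ofReal_pow (norm_nonneg _),
          norm_smul, mul_pow, Real.norm_eq_abs, sq_abs]
      rw [transportCost, hγ, lintegral_map (by fun_prop) hgm]
      simp only [h3]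
      rw [← ofReal_integral_eq_lintegral_ofReal (hgsq.const_mul _)
        (.of_forall fun x => by positivity), integral_const_mul, mul_pow, hN,
        Real.sq_sqrt (integral_nonneg fun x => by positivity)]
    rw [h2, ENNReal.ofReal_eq_ofReal_iff (by positivity) (by positivity)] at h1
    exact ((sq_eq_sq₀ (by positivity) (W2_nonneg μ ν)).1 h1).symm
  have hpair : ∀ θ : E p → E p, MemLp θ 2 μ.1 → ∫ z, inner ℝ (θ z.1) (z.2 - z.1) ∂γ
      = t * ∫ x, inner ℝ (θ x) (gradient ψ x) ∂μ.1 := fun θ hθ => by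
    have hfst : γ.map Prod.fst = μ.1 := hopt.1.1
    have hm : AEStronglyMeasurable (fun z : E p × E p => inner ℝ (θ z.1) (z.2 - z.1)) γ := by
      refine AEStronglyMeasurable.inner ?_ (by fun_prop)
      have h := hθ.1
      rw [← hfst] at h
      exact h.comp_measurable measurable_fst
    rw [hγ] at hm ⊢
    rw [integral_map hgm.aemeasurable hm, ← integral_const_mul]
    simp only [add_sub_cancel_left, inner_smul_right]
  have a₁ := h₁ ν (by rwa [hW]) γ hopt
  have a₂ := h₂ ν (by rwa [hW]) γ hopt
  rw [hpair ζ hζ.1, hW] at a₁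
  rw [hpair (-ξ) hξ.1, hW] at a₂
  simp only [Pi.neg_apply, inner_neg_left, integral_neg] at a₂
  have key : t * (∫ x, inner ℝ (ζ x) (gradient ψ x) ∂μ.1)
      ≤ t * ((∫ x, inner ℝ (ξ x) (gradient ψ x) ∂μ.1) + 2 * (ε / (2 * (N + 1)) * N)) := by
    linarith
  have hsmall : 2 * (ε / (2 * (N + 1)) * N) ≤ ε := by
    have : ε / (2 * (N + 1)) * (2 * (N + 1)) = ε := by field_simp
    have : 0 < ε / (2 * (N + 1)) := by positivity
    linarith
  linarith [le_of_mul_le_mul_left key ht]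

/-- Orthogonality to all `∇ψ` passes to their `L²(μ)`-closure. -/
theorem integral_inner_eq_zero_of_orthogonal {μ : P2 p} {θ ζ : E p → E p} (hθ : MemLp θ 2 μ.1)
    (hζ : InTangentSpace μ ζ)
    (h : ∀ ψ : E p → ℝ, ContDiff ℝ ∞ ψ → HasCompactSupport ψ →
      ∫ x, inner ℝ (θ x) (gradient ψ x) ∂μ.1 = 0) :
    ∫ x, inner ℝ (θ x) (ζ x) ∂μ.1 = 0 := by
  rw [← abs_nonpos_iff]
  set A := (eLpNorm θ 2 μ.1).toReal with hA
  have hA0 : 0 ≤ A := ENNReal.toReal_nonneg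
  refine le_of_forall_pos_le_add fun ε hε => ?_
  obtain ⟨ψ, hψ, hc, hlt⟩ := hζ.2 (ε / (A + 1)) (by positivity)
  have hg := memLp_gradient hψ hc μ
  have e : ∫ x, inner ℝ (θ x) (ζ x) ∂μ.1 = ∫ x, inner ℝ (θ x) (ζ x - gradient ψ x) ∂μ.1 := by
    simp only [inner_sub_right]
    rw [integral_sub (integrable_inner_of_memLp_two hθ hζ.1) (integrable_inner_of_memLp_two hθ hg),
      h ψ hψ hc, sub_zero]
  rw [e, zero_add]
  refine (abs_integral_inner_le hθ (hζ.1.sub hg)).trans ?_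
  have h1 : (eLpNorm (ζ - gradient ψ) 2 μ.1).toReal ≤ ε / (A + 1) :=
    ENNReal.toReal_le_of_le_ofReal (by positivity) hlt.le
  calc A * (eLpNorm (ζ - gradient ψ) 2 μ.1).toReal ≤ A * (ε / (A + 1)) := by gcongr
    _ ≤ (A + 1) * (ε / (A + 1)) := by gcongr; linarith
    _ = ε := by field_simp

theorem IsWassersteinGradient.ae_eq {G : P2 p → ℝ} {μ : P2 p} {ζ ξ : E p → E p}
    (hζ : IsWassersteinGradient G μ ζ) (hξ : IsWassersteinGradient G μ ξ) : ζ =ᵐ[μ.1] ξ := by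
  have hζL := hζ.1.1
  have hξL := hξ.1.1
  have hθ : MemLp (ζ - ξ) 2 μ.1 := hζL.sub hξL
  have horth : ∀ ψ : E p → ℝ, ContDiff ℝ ∞ ψ → HasCompactSupport ψ →
      ∫ x, inner ℝ ((ζ - ξ) x) (gradient ψ x) ∂μ.1 = 0 := fun ψ hψ hc => by
    have hg := memLp_gradient hψ hc μ
    simp only [Pi.sub_apply, inner_sub_left]
    rw [integral_sub (integrable_inner_of_memLp_two hζL hg) (integrable_inner_of_memLp_two hξL hg),
      sub_eq_zero]
    exact le_antisymm (integral_inner_gradient_le hζ.1 hξ.2.1 hψ hc)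
      (integral_inner_gradient_le hξ.1 hζ.2.1 hψ hc)
  have h1 := integral_inner_eq_zero_of_orthogonal hθ hζ.2.2 horth
  have h2 := integral_inner_eq_zero_of_orthogonal hθ hξ.2.2 horth
  have h3 : ∫ x, inner ℝ ((ζ - ξ) x) ((ζ - ξ) x) ∂μ.1 = 0 := by
    simp only [Pi.sub_apply (f := ζ), inner_sub_right]
    have i1 := integrable_inner_of_memLp_two hθ hζL
    have i2 := integrable_inner_of_memLp_two hθ hξL
    simp only [Pi.sub_apply] at i1 i2 h1 h2
    rw [integral_sub i1 i2, h1, h2, sub_zero]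
  rw [integral_eq_zero_iff_of_nonneg (fun x => real_inner_self_nonneg)
    (integrable_inner_of_memLp_two hθ hθ)] at h3
  filter_upwards [h3] with x hx
  exact sub_eq_zero.1 (inner_self_eq_zero.1 hx)

end Uniqueness

/-! ### The self-discrepancy as an interaction energy -/

section SelfMMD

variable {p : ℕ}

/-- The kernel `φ` with `MMD²(ν, T_# ν) = ∬ φ d(ν ⊗ ν)`; it is symmetric if `k` is. -/
def mmdKernel (k : E p → E p → ℝ) (T : E p → E p) (z : E p × E p) : ℝ :=
  k z.1 z.2 - k z.1 (T z.2) - k (T z.1) z.2 + k (T z.1) (T z.2)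

variable {k : E p → E p → ℝ} {T : E p → E p}

theorem isQuadLipschitz_mmdKernel (hk : IsQuadLipschitz fun z : E p × E p => k z.1 z.2)
    {M : NNReal} (hT : LipschitzWith M T) : IsQuadLipschitz (mmdKernel k T) := by
  have h1 := hT.comp (LipschitzWith.prod_fst (α := E p) (β := E p))
  have h2 := hT.comp (LipschitzWith.prod_snd (α := E p) (β := E p))
  exact ((hk.sub (hk.comp_lipschitz (LipschitzWith.prod_fst.prodMk h2))).sub
    (hk.comp_lipschitz (h1.prodMk LipschitzWith.prod_snd))).add (hk.comp_lipschitz (h1.prodMk h2))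

theorem mmdKernel_swap (hk : ∀ x y, k x y = k y x) (z : E p × E p) :
    mmdKernel k T z.swap = mmdKernel k T z := by
  simp only [mmdKernel, Prod.fst_swap, Prod.snd_swap]
  rw [hk z.2 z.1, hk z.2 (T z.1), hk (T z.2) z.1, hk (T z.2) (T z.1)]
  ring

theorem differentiableAt_mmdKernel (hk : Differentiable ℝ fun z : E p × E p => k z.1 z.2)
    {z : E p × E p} (h1 : DifferentiableAt ℝ T z.1) (h2 : DifferentiableAt ℝ T z.2) :
    DifferentiableAt ℝ (mmdKernel k T) z := by
  have h1' : DifferentiableAt ℝ (fun z : E p × E p => T z.1) z := h1.comp z differentiableAt_fst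
  have h2' : DifferentiableAt ℝ (fun z : E p × E p => T z.2) z := h2.comp z differentiableAt_snd
  have hc : ∀ {a b : E p × E p → E p}, DifferentiableAt ℝ a z → DifferentiableAt ℝ b z →
      DifferentiableAt ℝ (fun z => k (a z) (b z)) z := fun {a b} ha hb =>
    DifferentiableAt.comp (f := fun z => (a z, b z)) z (hk (a z, b z)) (ha.prodMk hb)
  exact (((hc differentiableAt_fst differentiableAt_snd).sub (hc differentiableAt_fst h2')).sub
    (hc h1' differentiableAt_snd)).add (hc h1' h2')

theorem ae_differentiableAt_mmdKernel (hk : Differentiable ℝ fun z : E p × E p => k z.1 z.2)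
    {μ : P2 p} (hT : ∀ᵐ x ∂μ.1, DifferentiableAt ℝ T x) :
    ∀ᵐ z ∂μ.1.prod μ.1, DifferentiableAt ℝ (mmdKernel k T) z := by
  filter_upwards [Measure.quasiMeasurePreserving_fst.ae hT,
    Measure.quasiMeasurePreserving_snd.ae hT] with z h1 h2
  exact differentiableAt_mmdKernel hk h1 h2

theorem integral_mmdKernel_section (hk : IsQuadLipschitz fun z : E p × E p => k z.1 z.2)
    {M : NNReal} (hT : LipschitzWith M T) (μ : P2 p) (x : E p) :
    ∫ y, mmdKernel k T (x, y) ∂μ.1 = witness k T μ x - witness k T μ (T x) := by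
  have hi : ∀ x, Integrable (fun y => k x y) μ.1 := fun x =>
    (hk.section_left x).integrable μ.2.integrable_norm_sq
  have hiT : ∀ x, Integrable (fun y => k x (T y)) μ.1 := fun x =>
    ((hk.section_left x).comp_lipschitz hT).integrable μ.2.integrable_norm_sq
  have hmap : ∀ x, ∫ y, k x y ∂(μ.1.map T) = ∫ y, k x (T y) ∂μ.1 := fun x =>
    integral_map hT.continuous.measurable.aemeasurable
      (hk.section_left x).continuous.measurable.aestronglyMeasurable
  simp only [mmdKernel, witness, hmap]
  rw [integral_add (by exact ((hi x).sub (hiT x)).sub (hi (T x))) (hiT (T x)),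
    integral_sub (by exact (hi x).sub (hiT x)) (hi (T x)), integral_sub (hi x) (hiT x)]
  ring

theorem selfMMD_eq (hk : IsQuadLipschitz fun z : E p × E p => k z.1 z.2)
    {M : NNReal} (hT : LipschitzWith M T) (ν : P2 p) :
    selfMMD k T ν = 1 / 2 * ∫ z, mmdKernel k T z ∂ν.1.prod ν.1 := by
  have hTm := hT.continuous.measurable.aemeasurable (μ := ν.1)
  let ν' : P2 p := ⟨ν.1.map T, ν.2.map_lipschitz hT⟩
  have hq : ∀ α : P2 p, IsQuadLipschitz fun x => ∫ y, k x y ∂α.1 := fun α =>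
    hk.integral_right α.2.integrable_norm_sq
  have hw : IsQuadLipschitz (witness k T ν) := (hq ν).sub (hq ν')
  have hφ := isQuadLipschitz_mmdKernel hk hT
  rw [integral_prod _ (hφ.integrable
    (integrable_norm_sq_prod ν.2.integrable_norm_sq ν.2.integrable_norm_sq))]
  simp only [integral_mmdKernel_section hk hT ν]
  have iν := fun α : P2 p => (hq α).integrable ν.2.integrable_norm_sq
  have iν' := fun α : P2 p => (hq α).integrable ν'.2.integrable_norm_sq
  have e : ∫ x, witness k T ν (T x) ∂ν.1 = ∫ x, witness k T ν x ∂ν'.1 :=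
    (integral_map hTm hw.continuous.measurable.aestronglyMeasurable).symm
  rw [integral_sub (hw.integrable ν.2.integrable_norm_sq)
    ((hw.comp_lipschitz hT).integrable ν.2.integrable_norm_sq), e]
  have e1 : ∫ x, witness k T ν x ∂ν.1 = (∫ x, ∫ y, k x y ∂ν.1 ∂ν.1) - ∫ x, ∫ y, k x y ∂ν'.1 ∂ν.1 :=
    integral_sub (iν ν) (iν ν')
  have e2 : ∫ x, witness k T ν x ∂ν'.1
      = (∫ x, ∫ y, k x y ∂ν.1 ∂ν'.1) - ∫ x, ∫ y, k x y ∂ν'.1 ∂ν'.1 :=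
    integral_sub (iν' ν) (iν' ν')
  rw [e1, e2, selfMMD, mmdSq]
  ring

end SelfMMD

/-! ### Invariance under equality almost everywhere -/

section Congr

variable {p : ℕ} {μ : P2 p} {G : P2 p → ℝ} {ζ ξ : E p → E p}

theorem IsSubgradient.congr_ae (h : IsSubgradient G μ ζ) (hζξ : ζ =ᵐ[μ.1] ξ) :
    IsSubgradient G μ ξ := by
  refine ⟨(memLp_congr_ae hζξ).1 h.1, fun ε hε => ?_⟩
  obtain ⟨δ, hδ, hb⟩ := h.2 ε hε
  refine ⟨δ, hδ, fun ν hν γ hγ => ?_⟩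
  have hae : ∀ᵐ z ∂γ, ζ z.1 = ξ z.1 := by
    have h1 := hζξ
    rw [← hγ.1.1] at h1
    exact ae_of_ae_map measurable_fst.aemeasurable h1
  have he : ∫ z, inner ℝ (ζ z.1) (z.2 - z.1) ∂γ = ∫ z, inner ℝ (ξ z.1) (z.2 - z.1) ∂γ :=
    integral_congr_ae (hae.mono fun z hz => by simp only [hz])
  exact he ▸ hb ν hν γ hγ

theorem InTangentSpace.congr_ae (h : InTangentSpace μ ζ) (hζξ : ζ =ᵐ[μ.1] ξ) :
    InTangentSpace μ ξ := by
  refine ⟨(memLp_congr_ae hζξ).1 h.1, fun ε hε => ?_⟩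
  obtain ⟨ψ, hψ, hc, hlt⟩ := h.2 ε hε
  refine ⟨ψ, hψ, hc, ?_⟩
  have he : eLpNorm (fun x => ζ x - gradient ψ x) 2 μ.1
      = eLpNorm (fun x => ξ x - gradient ψ x) 2 μ.1 :=
    eLpNorm_congr_ae (hζξ.mono fun x hx => by simp only [hx])
  exact he ▸ hlt

theorem IsWassersteinGradient.congr_ae (h : IsWassersteinGradient G μ ζ) (hζξ : ζ =ᵐ[μ.1] ξ) :
    IsWassersteinGradient G μ ξ :=
  ⟨h.1.congr_ae hζξ, h.2.1.congr_ae (hζξ.mono fun x hx => by simp only [Pi.neg_apply, hx]),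
    h.2.2.congr_ae hζξ⟩

end Congr

/-! ### The Wasserstein gradient of the self-discrepancy -/

theorem isWassersteinGradient_selfMMD {p : ℕ} {k : E p → E p → ℝ} {T : E p → E p} {M : NNReal}
    (hk : IsQuadLipschitz fun z : E p × E p => k z.1 z.2) (hk_symm : ∀ x y, k x y = k y x)
    (hk_diff : Differentiable ℝ fun z : E p × E p => k z.1 z.2) (hT : LipschitzWith M T) {μ : P2 p}
    (hT_diff : ∀ᵐ x ∂μ.1, DifferentiableAt ℝ T x)
    (hd : ∀ᵐ x ∂μ.1, DifferentiableAt ℝ (fun x => witness k T μ x - witness k T μ (T x)) x) :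
    IsWassersteinGradient (selfMMD k T) μ
      (gradient fun x => witness k T μ x - witness k T μ (T x)) := by
  have hφ := isQuadLipschitz_mmdKernel hk hT
  have hF : IsQuadLipschitz fun x => witness k T μ x - witness k T μ (T x) := by
    simp only [← integral_mmdKernel_section hk hT μ]
    exact hφ.integral_right μ.2.integrable_norm_sq
  have htan := inTangentSpace_gradient hF μ hd
  have hexp : ∀ ε : ℝ, 0 < ε → ∃ δ : ℝ, 0 < δ ∧ ∀ ν : P2 p, W2 μ ν < δ →
      ∀ γ ∈ optimalCouplings μ.1 ν.1, |selfMMD k T ν - selfMMD k T μ - ∫ z, inner ℝ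
        (gradient (fun x => witness k T μ x - witness k T μ (T x)) z.1) (z.2 - z.1) ∂γ|
        ≤ ε * W2 μ ν := fun ε hε => by
    simp only [selfMMD_eq hk hT]
    simp only [← integral_mmdKernel_section hk hT μ] at hd ⊢
    exact exists_energy_expansion hφ (mmdKernel_swap hk_symm) μ
      (ae_differentiableAt_mmdKernel hk_diff hT_diff) hd hε
  refine ⟨⟨htan.1, fun ε hε => ?_⟩, ⟨htan.1.neg, fun ε hε => ?_⟩, htan⟩ <;>
    obtain ⟨δ, hδ, h⟩ := hexp ε hε <;> refine ⟨δ, hδ, fun ν hν γ hγ => ?_⟩ <;>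
    have h1 := abs_le.1 (h ν hν γ hγ)
  · linarith [h1.1]
  · simp only [Pi.neg_apply, inner_neg_left, integral_neg]
    linarith [h1.2]

theorem corollary2 (p : ℕ) (k : E p → E p → ℝ)
    (hk_symm : ∀ x y, k x y = k y x)
    (hk_diff : Differentiable ℝ (fun z : E p × E p => k z.1 z.2))
    (hk_growth : ∃ C : ℝ, ∀ x y, ‖gradient (fun x' => k x' y) x‖ ≤ C * (1 + ‖x‖ + ‖y‖))
    (T : E p → E p) (μ : P2 p)
    (hT_lip : ∃ M : NNReal, LipschitzWith M T)
    (hT_diff : ∀ᵐ x ∂μ.1, DifferentiableAt ℝ T x) :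
    -- the push-forward and all the integrals in the objective and the witness are well defined
    (∀ ν : P2 p, IsP2 (ν.1.map T)) ∧
    (∀ ν ν' : P2 p, Integrable (fun z : E p × E p => k z.1 z.2) (ν.1.prod ν'.1)) ∧
    (∀ (ν : P2 p) (x : E p), Integrable (fun y => k x y) ν.1) ∧
    -- the two gradients in the formula exist
    Differentiable ℝ (witness k T μ) ∧
    (∀ᵐ x ∂μ.1, DifferentiableAt ℝ (witness k T μ ∘ T) x) ∧
    -- the Wasserstein gradient exists and is given by the formula
    IsWassersteinGradient (selfMMD k T) μ
      (fun x => gradient (witness k T μ) x - gradient (witness k T μ ∘ T) x) ∧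
    -- it is the only one, up to equality almost everywhere
    (∀ ζ : E p → E p, IsWassersteinGradient (selfMMD k T) μ ζ →
      ζ =ᵐ[μ.1] fun x => gradient (witness k T μ) x - gradient (witness k T μ ∘ T) x) := by
  have hk := isQuadLipschitz_kernel hk_symm hk_diff hk_growth
  obtain ⟨M, hT⟩ := hT_lip
  have hpot : ∀ ν : P2 p, Differentiable ℝ fun x => ∫ y, k x y ∂ν.1 := fun ν x =>
    hk.differentiableAt_integral_right ν.2.integrable_norm_sq fun y =>
      hk_diff.comp (differentiable_id.prodMk (differentiable_const y)) x
  have hw : Differentiable ℝ (witness k T μ) :=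
    (hpot μ).sub (hpot ⟨μ.1.map T, μ.2.map_lipschitz hT⟩)
  have hwT : ∀ᵐ x ∂μ.1, DifferentiableAt ℝ (witness k T μ ∘ T) x := by
    filter_upwards [hT_diff] with x hx using (hw (T x)).comp x hx
  have hgrad : IsWassersteinGradient (selfMMD k T) μ
      (fun x => gradient (witness k T μ) x - gradient (witness k T μ ∘ T) x) := by
    refine (isWassersteinGradient_selfMMD hk hk_symm hk_diff hT hT_diff ?_).congr_ae ?_
    · filter_upwards [hwT] with x hx using (hw x).sub hx
    · filter_upwards [hwT] with x hx
      refine HasGradientAt.gradient ?_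
      rw [hasGradientAt_iff_hasFDerivAt, map_sub, toDual_gradient, toDual_gradient]
      exact (hw x).hasFDerivAt.sub hx.hasFDerivAt
  exact ⟨fun ν => ν.2.map_lipschitz hT,
    fun ν ν' => hk.integrable
      (integrable_norm_sq_prod ν.2.integrable_norm_sq ν'.2.integrable_norm_sq),
    fun ν x => (hk.section_left x).integrable ν.2.integrable_norm_sq,
    hw, hwT, hgrad, fun ζ hζ => hζ.ae_eq hgrad⟩
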